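/- Throughout, a \emph{topos} is an elementary topos: a category with chosen finite products, all finite limits, chosen exponentials and a subobject classifier $\mathrm{true}\colon 1\to\Omega$. A functor $L\colon\mathcal E\to\mathcal F$ between toposes is \emph{logical} if it preserves finite products, exponentials (the canonical maps $L(B^A)\to L(B)^{L(A)}$ are isomorphisms) and the subobject classifier ($L(\mathrm{true})$ is a subobject classifier of $\mathcal F$). An \emph{internal commutative quantale} $(Q,\otimes,k,\bigvee)$ in a topos $\mathcal E$ is an object $Q$ with morphisms $\otimes\colon Q\times Q\to Q$, $k\colon 1\to Q$, $\bigvee\colon\Omega^Q\to Q$ and an order relation ${\le}\colon Q\times Q\to\Omega$ satisfying, in the internal language of $\mathcal E$: $\le$ is a partial order for which $\bigvee S$ is the least upper bound of $S$; $(Q,\otimes,k)$ is a commutative monoid; $a\otimes\bigvee S=\bigvee\{a\otimes s\mid s\in S\}$ and $\bigvee S\otimes a=\bigvee\{s\otimes a\mid s\in S\}$. For a logical functor $L\colon\mathcal E\to\mathcal F$, $LQ$ denotes the object $L(Q)$ with the images of these morphisms, transported along the canonical isomorphisms $L(Q\times Q)\cong LQ\times LQ$, $L(1)\cong 1$, $L(\Omega)\cong\Omega$,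 $L(\Omega^Q)\cong\Omega^{LQ}$. Let $(\Sigma,E)$ be an algebraic signature: a set of operation symbols of finite arity and a set of equations between terms, each in finitely many variables. The category $\mathbf{Rel}^{\mathcal E}_{(\Sigma,E)}(Q)$ has as objects the $(\Sigma,E)$-algebras in $\mathcal E$, and as morphisms $A\to B$ the algebraic $Q$-relations, i.e. the morphisms $R\colon A\times B\to Q$ of $\mathcal E$ such that, in the internal language, $R(a_1,b_1)\otimes\dots\otimes R(a_n,b_n)\le R(\sigma(a_1,\dots,a_n),\sigma(b_1,\dots,b_n))$ for every $n$-ary $\sigma\in\Sigma$. The identity on $A$ is $(a,a')\mapsto\bigvee\{k\mid a=a'\}$ and the composite of $R\colon A\to B$ and $S\colon B\to C$ is $(a,c)\mapsto\bigvee\{R(a,b)\otimes S(b,c)\mid b\in B\}$. It is a symmetric monoidal category: $A\otimes B$ is the product algebra $A\times B$, the unit is the terminal algebra, $(R\otimes R')((a,a'),(b,b'))=R(a,b)\otimes R'(a',b')$, and the structural isomorphisms are the graphs $(a,b)\mapsto\bigvee\{k\mid f(a)=b\}$ of the structural isomorphisms $f$ of the finite products of $\mathcal E$. \textbf{Theorem.}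 Let $(\Sigma,E)$ be an algebraic signature. \begin{enumerate} \item If $L\colon\mathcal E\to\mathcal F$ is a logical functor between toposes and $Q$ is an internal commutative quantale in $\mathcal E$, then $LQ$ is an internal commutative quantale in $\mathcal F$. \item To every such $L$ and $Q$ one can assign a (strong) symmetric monoidal functor \[L^*\colon \mathbf{Rel}^{\mathcal E}_{(\Sigma,E)}(Q)\longrightarrow\mathbf{Rel}^{\mathcal F}_{(\Sigma,E)}(LQ)\] which sends an algebra $A$ to $L(A)$, with the operations $L(A)^n\cong L(A^n)\to L(A)$, and an algebraic $Q$-relation $R\colon A\times B\to Q$ to $L(A)\times L(B)\xrightarrow{\ \kappa\ }L(A\times B)\xrightarrow{\ L(R)\ }L(Q)$, where $\kappa$ is the canonical isomorphism. \item The assignment $L\mapsto L^*$ is functorial: one can choose the symmetric monoidal structures in (2) so that, as symmetric monoidal functors, $(\mathrm{id}_{\mathcal E})^*=\mathrm{id}$, and $(K\circ L)^*=K^*\circ L^*$ for all logical functors $L\colon\mathcal E\to\mathcal F$ and $K\colon\mathcal F\to\mathcal G$ (here $\mathrm{id}_{\mathcal E}Q=Q$ and $(KL)Q=K(LQ)$).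 \end{enumerate} -/

import Mathlib

open CategoryTheory MonoidalCategory CartesianMonoidalCategory
open CategoryTheory.Limits hiding prodComparison terminalComparison

universe w v u v₁ u₁ v₂ u₂ v₃ u₃

namespace ToposRel

noncomputable section

/-- An elementary topos: a category with (chosen) finite products, finite limits, (chosen)
exponentials and a subobject classifier. -/
class ElementaryTopos (E : Type u) [Category.{v} E] extends CartesianMonoidalCategory E,
  MonoidalClosed E, HasFiniteLimits E, HasSubobjectClassifier E

open HasSubobjectClassifier

section Logic

variable {E : Type u} [Category.{v} E] [ElementaryTopos E]

/-- The truth value "true", at stage `X`. -/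
def tt (X : E) : X ⟶ Ω E := Subobject.Classifier.χ₀ _ X ≫ truth E

/-- The power object of `A`. -/
abbrev Pow (A : E) : E := (ihom A).obj (Ω E)

/-- The truth value of `a ∈ S`, at stage `X`. -/
def mem {A X : E} (a : X ⟶ A) (S : X ⟶ Pow A) : X ⟶ Ω E :=
  lift a S ≫ (ihom.ev A).app (Ω E)

/-- The internal subset `{a | P(a, x)}` of `A`, depending on the parameter `x`. -/
def comprehension {A X : E} (P : A ⊗ X ⟶ Ω E) : X ⟶ Pow A := MonoidalClosed.curry P

@[simp]
lemma comp_tt {X Y : E} (f : X ⟶ Y) : f ≫ tt Y = tt X := by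
  unfold tt
  rw [← Category.assoc]
  congr 1
  exact Subsingleton.elim _ _

lemma comp_mem {A X Y : E} (f : Y ⟶ X) (a : X ⟶ A) (S : X ⟶ Pow A) :
    f ≫ mem a S = mem (f ≫ a) (f ≫ S) := by
  simp [mem, ← Category.assoc]

lemma mem_comprehension {A X Y : E} (P : A ⊗ X ⟶ Ω E) (a : Y ⟶ A) (f : Y ⟶ X) :
    mem a (f ≫ comprehension P) = lift a f ≫ P := by
  have : lift a (f ≫ comprehension P) = lift a f ≫ (A ◁ comprehension P) := by simp
  unfold mem
  rw [this, Category.assoc, ← MonoidalClosed.uncurry_eq, comprehension,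
    MonoidalClosed.uncurry_curry]

lemma comp_chi_eq_tt_iff {U X T : E} (m : U ⟶ X) [Mono m] (p : T ⟶ X) :
    p ≫ χ m = tt T ↔ ∃ l : T ⟶ U, l ≫ m = p := by
  constructor
  · intro h
    exact ⟨(isPullback_χ m).lift p (Subobject.Classifier.χ₀ _ T) h,
      (isPullback_χ m).lift_fst _ _ _⟩
  · rintro ⟨l, rfl⟩
    rw [Category.assoc, HasSubobjectClassifier.comm, ← Category.assoc]
    unfold tt
    congr 1
    exact Subsingleton.elim _ _

lemma omega_ext {X : E} {a b : X ⟶ Ω E}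
    (h : ∀ (T : E) (p : T ⟶ X), p ≫ a = tt T ↔ p ≫ b = tt T) : a = b := by
  have key : ∀ c : X ⟶ Ω E, (∀ (T : E) (p : T ⟶ X), p ≫ a = tt T ↔ p ≫ c = tt T) →
      c = χ (equalizer.ι a (tt X)) := by
    intro c hc
    apply HasSubobjectClassifier.unique
    refine ⟨⟨?_⟩, ⟨PullbackCone.IsLimit.mk _ (fun s => equalizer.lift s.fst ?_) ?_ ?_ ?_⟩⟩
    · refine ((hc _ _).1 ?_).trans rfl
      rw [equalizer.condition, comp_tt]
    · rw [comp_tt, hc, s.condition]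
      unfold tt
      congr 1
      exact Subsingleton.elim _ _
    · intro s; simp
    · intro s; exact Subsingleton.elim _ _
    · intro s l h1 _
      rw [← cancel_mono (equalizer.ι a (tt X)), h1]
      simp
  rw [key a (fun _ _ => Iff.rfl), ← key b h]

/-- Universal quantification along `v`: the subobject `{z | ∀ w, v w = z → φ w}`. -/
lemma exists_forall {W Z : E} (f : W ⟶ Z) (φ : W ⟶ Ω E) :
    ∃ (N : E) (n : N ⟶ Z) (_ : Mono n), ∀ (V : E) (e : V ⟶ Z),
      (∃ l : V ⟶ N, l ≫ n = e) ↔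
        ∀ (T : E) (t : T ⟶ W) (a : T ⟶ V), t ≫ f = a ≫ e → t ≫ φ = tt T := by
  have m1 : Mono (lift (𝟙 W) f) := mono_lift_of_mono_left _ _
  let k := equalizer.ι φ (tt W)
  have m2 : Mono (k ≫ lift (𝟙 W) f) := mono_comp _ _
  let g1 := comprehension (χ (lift (𝟙 W) f))
  let g2 := comprehension (χ (k ≫ lift (𝟙 W) f))
  have h1 : ∀ {T : E} (t : T ⟶ W) (z : T ⟶ Z),
      lift t z ≫ χ (lift (𝟙 W) f) = tt T ↔ t ≫ f = z := by
    intro T t z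
    rw [comp_chi_eq_tt_iff]
    constructor
    · rintro ⟨l, hl⟩
      have a1 := congrArg (· ≫ fst _ _) hl
      have a2 := congrArg (· ≫ snd _ _) hl
      simp at a1 a2
      rw [← a1, a2]
    · rintro rfl
      exact ⟨t, by simp⟩
  have h2 : ∀ {T : E} (t : T ⟶ W) (z : T ⟶ Z),
      lift t z ≫ χ (k ≫ lift (𝟙 W) f) = tt T ↔ t ≫ f = z ∧ t ≫ φ = tt T := by
    intro T t z
    rw [comp_chi_eq_tt_iff]
    constructor
    · rintro ⟨l, hl⟩
      have a1 := congrArg (· ≫ fst _ _) hl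
      have a2 := congrArg (· ≫ snd _ _) hl
      simp at a1 a2
      rw [← a1]
      refine ⟨by simpa using a2, ?_⟩
      rw [Category.assoc, equalizer.condition]
      simp
    · rintro ⟨rfl, h⟩
      exact ⟨equalizer.lift t (by simpa using h), by simp [k]⟩
  refine ⟨equalizer g1 g2, equalizer.ι g1 g2, inferInstance, fun V e => ?_⟩
  trans e ≫ g1 = e ≫ g2
  · constructor
    · rintro ⟨l, rfl⟩
      rw [Category.assoc, Category.assoc, equalizer.condition]
    · intro h
      exact ⟨equalizer.lift e h, by simp⟩
  · constructor
    · intro h T t a hta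
      have := mem_comprehension (χ (lift (𝟙 W) f)) t (a ≫ e)
      have h' : mem t ((a ≫ e) ≫ g1) = mem t ((a ≫ e) ≫ g2) := by
        simp only [Category.assoc, h]
      rw [mem_comprehension, mem_comprehension, (h1 _ _).2 hta] at h'
      exact ((h2 _ _).1 h'.symm).2
    · intro h
      have hc : ∀ P : W ⊗ Z ⟶ Ω E,
          e ≫ comprehension P = comprehension ((W ◁ e) ≫ P) := by
        intro P
        exact (MonoidalClosed.curry_natural_left _ _).symm
      rw [hc, hc]
      congr 1
      refine omega_ext fun T p => ?_
      have hp : p ≫ (W ◁ e) = lift (p ≫ fst _ _) ((p ≫ snd _ _) ≫ e) := by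
        ext <;> simp
      rw [← Category.assoc, ← Category.assoc, hp, h1, h2]
      exact ⟨fun q => ⟨q, h _ _ _ q⟩, fun q => q.1⟩

/-- The image of `h` is `{z | ∀ S, (∀ i, h i ∈ S) → z ∈ S}`. -/
lemma exists_image {I Z : E} (h : I ⟶ Z) :
    ∃ (N : E) (n : N ⟶ Z) (_ : Mono n), (∃ l : I ⟶ N, l ≫ n = h) ∧
      ∀ (M : E) (m : M ⟶ Z) [Mono m], (∃ l : I ⟶ M, l ≫ m = h) → ∃ l : N ⟶ M, l ≫ m = n := by
  let p : Pow Z ⟶ Pow I := comprehension ((h ▷ Pow Z) ≫ (ihom.ev Z).app (Ω E))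
  let q : Pow Z ⟶ Pow I := comprehension (tt _)
  let ι := equalizer.ι p q
  have hp : ∀ {T : E} (a : T ⟶ I) (S : T ⟶ Pow Z), mem a (S ≫ p) = mem (a ≫ h) S := by
    intro T a S
    rw [mem_comprehension, ← Category.assoc, lift_whiskerRight]
    rfl
  have hq : ∀ {T : E} (a : T ⟶ I) (S : T ⟶ Pow Z), mem a (S ≫ q) = tt T := by
    intro T a S
    rw [mem_comprehension, comp_tt]
  obtain ⟨N, n, hn, H⟩ := exists_forall (fst Z (equalizer p q)) (mem (fst _ _) (snd _ _ ≫ ι))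
  refine ⟨N, n, hn, (H _ _).2 ?_, ?_⟩
  · intro T t a hta
    rw [comp_mem, hta, ← hp, ← Category.assoc, Category.assoc, equalizer.condition,
      ← Category.assoc, hq]
  · rintro M m hm ⟨l, hl⟩
    let S : 𝟙_ E ⟶ Pow Z := comprehension (fst _ _ ≫ χ m)
    have hS : S ≫ p = S ≫ q := by
      have e1 : S ≫ p = comprehension ((I ◁ S) ≫ (h ▷ Pow Z) ≫ (ihom.ev Z).app (Ω E)) :=
        (MonoidalClosed.curry_natural_left _ _).symm
      have e2 : S ≫ q = comprehension ((I ◁ S) ≫ tt _) :=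
        (MonoidalClosed.curry_natural_left _ _).symm
      rw [e1, e2, comp_tt]
      congr 1
      have e3 : (I ◁ S) ≫ (h ▷ Pow Z) = lift (fst _ _ ≫ h) (snd _ _ ≫ S) := by
        ext <;> simp
      rw [← Category.assoc, e3]
      change mem _ _ = _
      rw [mem_comprehension, ← Category.assoc, lift_fst, ← hl, comp_chi_eq_tt_iff]
      exact ⟨fst _ _ ≫ l, by simp⟩
    have := (H N n).1 ⟨𝟙 N, by simp⟩ N (lift n (toUnit _ ≫ equalizer.lift S hS)) (𝟙 N) (by simp)
    rw [comp_mem] at this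
    simp only [lift_fst, ← Category.assoc, lift_snd] at this
    have e4 : (toUnit N ≫ equalizer.lift S hS) ≫ ι = toUnit N ≫ S := by simp [ι]
    rw [e4, mem_comprehension, ← Category.assoc, lift_fst, comp_chi_eq_tt_iff] at this
    exact this

instance : HasImages E where
  has_image := fun {I Z} h => by
    choose N n hn hl hm using exists_image h
    choose l hl using hl
    exact HasImage.mk
      { F := { I := N, m := n, e := l, fac := hl }
        isImage :=
          { lift := fun F' => Classical.choose (hm F'.I F'.m ⟨F'.e, F'.fac⟩)
            lift_fac := fun F' => Classical.choose_spec (hm F'.I F'.m ⟨F'.e, F'.fac⟩) } }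

/-- The truth value of `∃ i, h i = z`, as a predicate in `z`. -/
def inImage {I Z : E} (h : I ⟶ Z) : Z ⟶ Ω E := χ (image.ι h)

lemma self_comp_inImage {I Z T : E} (h : I ⟶ Z) (i : T ⟶ I) :
    (i ≫ h) ≫ inImage h = tt T :=
  (comp_chi_eq_tt_iff _ _).2 ⟨i ≫ factorThruImage h, by simp⟩

lemma inImage_elim {I Z W : E} (h : I ⟶ Z) (z : W ⟶ Z) (hz : z ≫ inImage h = tt W)
    (φ : W ⟶ Ω E)
    (H : ∀ (T : E) (t : T ⟶ W) (i : T ⟶ I), t ≫ z = i ≫ h → t ≫ φ = tt T) : φ = tt W := by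
  obtain ⟨N, n, hn, K⟩ := exists_forall z φ
  obtain ⟨l, hl⟩ := (K _ h).2 H
  obtain ⟨r, hr⟩ := (comp_chi_eq_tt_iff _ _).1 hz
  let F : MonoFactorisation h := { I := N, m := n, e := l, fac := hl }
  have := (K _ z).1 ⟨r ≫ image.lift F, by
    rw [Category.assoc]
    have : image.lift F ≫ n = image.ι h := image.lift_fac F
    rw [this, hr]⟩ W (𝟙 W) (𝟙 W) rfl
  simpa using this

end Logic

/-- The data of an internal quantale `(Q, ⊗, k, ⋁)` together with its order relation. -/
@[ext]
structure QuantaleData (E : Type u) [Category.{v} E] [ElementaryTopos E] where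
  /-- the underlying object -/
  carrier : E
  /-- the multiplication -/
  mul : carrier ⊗ carrier ⟶ carrier
  /-- the unit -/
  unit : 𝟙_ E ⟶ carrier
  /-- the order relation -/
  le : carrier ⊗ carrier ⟶ Ω E
  /-- the join operation on internal subsets -/
  sup : Pow carrier ⟶ carrier

namespace QuantaleData

variable {E : Type u} [Category.{v} E] [ElementaryTopos E] (Q : QuantaleData E)

/-- The product `x ⊗ y` of two generalized elements. -/
def m {X : E} (x y : X ⟶ Q.carrier) : X ⟶ Q.carrier := lift x y ≫ Q.mul

/-- The unit `k`, as a generalized element. -/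
def one (X : E) : X ⟶ Q.carrier := toUnit X ≫ Q.unit

/-- The relation `x ≤ y` holds for the generalized elements `x` and `y`. -/
def Le {X : E} (x y : X ⟶ Q.carrier) : Prop := lift x y ≫ Q.le = tt X

/-- The internal join `⋁ {q i | i ∈ I, f i = x}`, depending on `x ∈ X`: this is `⋁` applied to
`{c | ∃ i, q i = c ∧ f i = x}`. -/
def join {I X : E} (q : I ⟶ Q.carrier) (f : I ⟶ X) : X ⟶ Q.carrier :=
  comprehension (inImage (lift q f)) ≫ Q.sup

variable {Q}

/-- For a family `S` of internal subsets of `Q` indexed by `X`, the object `{(s, x) | s ∈ S x}`. -/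
def Elements {X : E} (S : X ⟶ Pow Q.carrier) : E :=
  equalizer (mem (fst Q.carrier X) (snd Q.carrier X ≫ S)) (tt _)

/-- The projection `(s, x) ↦ s`. -/
def elt {X : E} (S : X ⟶ Pow Q.carrier) : Elements S ⟶ Q.carrier := equalizer.ι _ _ ≫ fst _ _

/-- The projection `(s, x) ↦ x`. -/
def idx {X : E} (S : X ⟶ Pow Q.carrier) : Elements S ⟶ X := equalizer.ι _ _ ≫ snd _ _

variable (Q)

/-- `Q` is an internal quantale. All axioms are read in the internal language, by quantifying over
generalized elements at all stages. -/
class IsQuantale : Prop where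
  le_refl : ∀ {X : E} (x : X ⟶ Q.carrier), Q.Le x x
  le_trans : ∀ {X : E} (x y z : X ⟶ Q.carrier), Q.Le x y → Q.Le y z → Q.Le x z
  le_antisymm : ∀ {X : E} (x y : X ⟶ Q.carrier), Q.Le x y → Q.Le y x → x = y
  /-- `⋁ S ≤ z` if and only if `∀ s, s ∈ S → s ≤ z`. -/
  sup_le_iff : ∀ {X : E} (S : X ⟶ Pow Q.carrier) (z : X ⟶ Q.carrier),
    Q.Le (S ≫ Q.sup) z ↔ ∀ (Y : E) (f : Y ⟶ X) (s : Y ⟶ Q.carrier),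
      mem s (f ≫ S) = tt Y → Q.Le s (f ≫ z)
  mul_assoc : ∀ {X : E} (x y z : X ⟶ Q.carrier), Q.m (Q.m x y) z = Q.m x (Q.m y z)
  one_mul : ∀ {X : E} (x : X ⟶ Q.carrier), Q.m (Q.one X) x = x
  mul_one : ∀ {X : E} (x : X ⟶ Q.carrier), Q.m x (Q.one X) = x
  /-- `a ⊗ ⋁ S = ⋁ {a ⊗ s | s ∈ S}`. -/
  mul_sup : ∀ {X : E} (a : X ⟶ Q.carrier) (S : X ⟶ Pow Q.carrier),
    Q.m a (S ≫ Q.sup) = Q.join (Q.m (idx S ≫ a) (elt S)) (idx S)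
  /-- `⋁ S ⊗ a = ⋁ {s ⊗ a | s ∈ S}`. -/
  sup_mul : ∀ {X : E} (S : X ⟶ Pow Q.carrier) (a : X ⟶ Q.carrier),
    Q.m (S ≫ Q.sup) a = Q.join (Q.m (elt S) (idx S ≫ a)) (idx S)

/-- `Q` is an internal commutative quantale. -/
class IsCommQuantale : Prop extends Q.IsQuantale where
  mul_comm : ∀ {X : E} (x y : X ⟶ Q.carrier), Q.m x y = Q.m y x

variable {Q}

lemma comp_m {X Y : E} (f : Y ⟶ X) (x y : X ⟶ Q.carrier) :
    f ≫ Q.m x y = Q.m (f ≫ x) (f ≫ y) := by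
  simp [m, ← Category.assoc]

lemma comp_one {X Y : E} (f : Y ⟶ X) : f ≫ Q.one X = Q.one Y := by
  simp [one, ← Category.assoc]

lemma Le.comp {X Y : E} {x y : X ⟶ Q.carrier} (h : Q.Le x y) (f : Y ⟶ X) :
    Q.Le (f ≫ x) (f ≫ y) := by
  unfold Le at *
  rw [← comp_lift, Category.assoc, h, comp_tt]

lemma mem_elt {X : E} (S : X ⟶ Pow Q.carrier) : mem (elt S) (idx S ≫ S) = tt _ := by
  have := equalizer.condition (mem (fst Q.carrier X) (snd Q.carrier X ≫ S)) (tt _)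
  rw [comp_mem, comp_tt, ← Category.assoc] at this
  exact this

lemma exists_elements {X Y : E} {S : X ⟶ Pow Q.carrier} {s : Y ⟶ Q.carrier} {f : Y ⟶ X}
    (h : mem s (f ≫ S) = tt Y) : ∃ e : Y ⟶ Elements S, e ≫ elt S = s ∧ e ≫ idx S = f := by
  have h' : lift s f ≫ mem (fst Q.carrier X) (snd Q.carrier X ≫ S) = lift s f ≫ tt _ := by
    rw [comp_mem, comp_tt, ← Category.assoc, lift_fst, lift_snd, h]
  refine ⟨equalizer.lift (lift s f) h', ?_, ?_⟩
  · have := equalizer.lift_ι (lift s f) h' =≫ fst _ _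
    rw [Category.assoc, lift_fst] at this
    exact this
  · have := equalizer.lift_ι (lift s f) h' =≫ snd _ _
    rw [Category.assoc, lift_snd] at this
    exact this

variable [Q.IsCommQuantale]

lemma sup_le_iff' {X : E} (S : X ⟶ Pow Q.carrier) (z : X ⟶ Q.carrier) :
    Q.Le (S ≫ Q.sup) z ↔ ∀ (Y : E) (f : Y ⟶ X) (s : Y ⟶ Q.carrier),
      mem s (f ≫ S) = tt Y → Q.Le s (f ≫ z) := IsQuantale.sup_le_iff S z

lemma join_le_iff {I X Y : E} (q : I ⟶ Q.carrier) (f : I ⟶ X) (y : Y ⟶ X)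
    (z : Y ⟶ Q.carrier) :
    Q.Le (y ≫ Q.join q f) z ↔ ∀ (T : E) (t : T ⟶ Y) (i : T ⟶ I), i ≫ f = t ≫ y →
      Q.Le (i ≫ q) (t ≫ z) := by
  unfold join
  rw [← Category.assoc, sup_le_iff']
  constructor
  · intro h T t i hi
    refine h T t (i ≫ q) ?_
    rw [← Category.assoc, mem_comprehension, ← hi, ← comp_lift, self_comp_inImage]
  · intro h T t s hs
    rw [← Category.assoc, mem_comprehension] at hs
    refine inImage_elim _ _ hs _ fun T' t' i hi => ?_
    have h1 := congrArg (· ≫ fst _ _) hi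
    have h2 := congrArg (· ≫ snd _ _) hi
    simp at h1 h2
    have := h T' (t' ≫ t) i (by rw [← h2, Category.assoc])
    rw [← h1, Category.assoc] at this
    rw [← Category.assoc, comp_lift]
    exact this

lemma m_sup_le_iff {Y : E} (d : Y ⟶ Q.carrier) (S : Y ⟶ Pow Q.carrier) (z : Y ⟶ Q.carrier) :
    Q.Le (Q.m d (S ≫ Q.sup)) z ↔ ∀ (T : E) (t : T ⟶ Y) (s : T ⟶ Q.carrier),
      mem s (t ≫ S) = tt T → Q.Le (Q.m (t ≫ d) s) (t ≫ z) := by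
  have e1 : Q.m d (S ≫ Q.sup) = 𝟙 Y ≫ Q.join (Q.m (idx S ≫ d) (elt S)) (idx S) := by
    rw [Category.id_comp, ← IsQuantale.mul_sup]
  rw [e1, join_le_iff]
  constructor
  · intro h T t s hs
    obtain ⟨e, e2, e3⟩ := exists_elements hs
    have := h T t e (by simpa using e3)
    rwa [comp_m, ← Category.assoc, e2, e3] at this
  · intro h T t i hi
    rw [Category.comp_id] at hi
    subst hi
    rw [comp_m, ← Category.assoc]
    refine h T _ _ ?_
    rw [Category.assoc, ← comp_mem, mem_elt, comp_tt]

lemma m_join_le_iff {I X Y : E} (d : Y ⟶ Q.carrier) (q : I ⟶ Q.carrier) (f : I ⟶ X) (y : Y ⟶ X)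
    (z : Y ⟶ Q.carrier) :
    Q.Le (Q.m d (y ≫ Q.join q f)) z ↔ ∀ (T : E) (t : T ⟶ Y) (i : T ⟶ I), i ≫ f = t ≫ y →
      Q.Le (Q.m (t ≫ d) (i ≫ q)) (t ≫ z) := by
  unfold join
  rw [← Category.assoc, m_sup_le_iff]
  constructor
  · intro h T t i hi
    refine h T t (i ≫ q) ?_
    rw [← Category.assoc, mem_comprehension, ← hi, ← comp_lift, self_comp_inImage]
  · intro h T t s hs
    rw [← Category.assoc, mem_comprehension] at hs
    refine inImage_elim _ _ hs _ fun T' t' i hi => ?_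
    have h1 := congrArg (· ≫ fst _ _) hi
    have h2 := congrArg (· ≫ snd _ _) hi
    simp at h1 h2
    have := h T' (t' ≫ t) i (by rw [← h2, Category.assoc])
    rw [← h1, Category.assoc] at this
    rw [← Category.assoc, comp_lift, comp_m]
    simpa [Le] using this

instance {X : E} : Std.Associative (Q.m (X := X)) := ⟨IsQuantale.mul_assoc⟩
instance {X : E} : Std.Commutative (Q.m (X := X)) := ⟨IsCommQuantale.mul_comm⟩

lemma one_m {X : E} (x : X ⟶ Q.carrier) : Q.m (Q.one X) x = x := IsQuantale.one_mul x
lemma m_one {X : E} (x : X ⟶ Q.carrier) : Q.m x (Q.one X) = x := IsQuantale.mul_one x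
lemma m_comm {X : E} (x y : X ⟶ Q.carrier) : Q.m x y = Q.m y x := IsCommQuantale.mul_comm x y

lemma le_refl {X : E} (x : X ⟶ Q.carrier) : Q.Le x x := IsQuantale.le_refl x

lemma Le.trans {X : E} {x y z : X ⟶ Q.carrier} (h : Q.Le x y) (h' : Q.Le y z) : Q.Le x z :=
  IsQuantale.le_trans _ _ _ h h'

lemma Le.of_eq {X : E} {x y : X ⟶ Q.carrier} (h : x = y) : Q.Le x y := h ▸ le_refl x

lemma eq_of_le_iff {X : E} {x y : X ⟶ Q.carrier} (h : ∀ z, Q.Le x z ↔ Q.Le y z) : x = y :=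
  IsQuantale.le_antisymm _ _ ((h y).2 (le_refl y)) ((h x).1 (le_refl x))

lemma m_mono_right {X : E} (d : X ⟶ Q.carrier) {x y : X ⟶ Q.carrier} (h : Q.Le x y) :
    Q.Le (Q.m d x) (Q.m d y) := by
  let S : X ⟶ Pow Q.carrier := comprehension (lift (fst Q.carrier X) (snd Q.carrier X ≫ y) ≫ Q.le)
  have hS : ∀ {T : E} (t : T ⟶ X) (s : T ⟶ Q.carrier), mem s (t ≫ S) = tt T ↔ Q.Le s (t ≫ y) := by
    intro T t s
    rw [mem_comprehension, ← Category.assoc, comp_lift]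
    simp [Le]
  have hy : S ≫ Q.sup = y := by
    refine IsQuantale.le_antisymm _ _ ?_ ?_
    · exact (sup_le_iff' S y).2 fun T t s hs => (hS _ _).1 hs
    · have := (sup_le_iff' S _).1 (le_refl _) X (𝟙 X) y ((hS _ _).2 (by simpa using le_refl y))
      simpa using this
  have := (m_sup_le_iff d S _).1 (le_refl _) X (𝟙 X) x ((hS _ _).2 (by simpa using h))
  simpa [hy] using this

lemma m_mono {X : E} {x x' y y' : X ⟶ Q.carrier} (hx : Q.Le x x') (hy : Q.Le y y') :
    Q.Le (Q.m x y) (Q.m x' y') := by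
  refine (m_mono_right x hy).trans ?_
  rw [m_comm x, m_comm x']
  exact m_mono_right y' hx

end QuantaleData

section Relations

variable {E : Type u} [Category.{v} E] [ElementaryTopos E] {Q : QuantaleData E}

/-- The truth value `R(a, b)`. -/
def ap {A B X : E} (R : A ⊗ B ⟶ Q.carrier) (a : X ⟶ A) (b : X ⟶ B) : X ⟶ Q.carrier :=
  lift a b ≫ R

variable (Q) in
/-- The identity relation `1(a, a') = ⋁ {k | a = a'}`. -/
def idRel (A : E) : A ⊗ A ⟶ Q.carrier := Q.join (Q.one A) (lift (𝟙 A) (𝟙 A))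

variable (Q) in
/-- The graph of a morphism, `f(a, b) = ⋁ {k | f a = b}`. -/
def graphRel {A B : E} (f : A ⟶ B) : A ⊗ B ⟶ Q.carrier := Q.join (Q.one A) (lift (𝟙 A) f)

/-- The composite relation `(a, c) ↦ ⋁ {R(a, b) ⊗ S(b, c) | b ∈ B}`. -/
def compRel {A B C : E} (R : A ⊗ B ⟶ Q.carrier) (S : B ⊗ C ⟶ Q.carrier) : A ⊗ C ⟶ Q.carrier :=
  Q.join (I := A ⊗ (B ⊗ C))
    (Q.m (ap R (fst A (B ⊗ C)) (snd A (B ⊗ C) ≫ fst B C))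
      (ap S (snd A (B ⊗ C) ≫ fst B C) (snd A (B ⊗ C) ≫ snd B C)))
    (lift (fst A (B ⊗ C)) (snd A (B ⊗ C) ≫ snd B C))

/-- The tensor product of relations, `((a, a'), (b, b')) ↦ R(a, b) ⊗ R'(a', b')`. -/
def tensorRel {A B A' B' : E} (R : A ⊗ B ⟶ Q.carrier) (R' : A' ⊗ B' ⟶ Q.carrier) :
    (A ⊗ A') ⊗ (B ⊗ B') ⟶ Q.carrier :=
  Q.m (ap R (fst (A ⊗ A') (B ⊗ B') ≫ fst A A') (snd (A ⊗ A') (B ⊗ B') ≫ fst B B'))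
    (ap R' (fst (A ⊗ A') (B ⊗ B') ≫ snd A A') (snd (A ⊗ A') (B ⊗ B') ≫ snd B B'))

lemma comp_ap {A B X Y : E} (f : Y ⟶ X) (R : A ⊗ B ⟶ Q.carrier) (a : X ⟶ A) (b : X ⟶ B) :
    f ≫ ap R a b = ap R (f ≫ a) (f ≫ b) := by
  simp [ap, ← Category.assoc]

lemma ap_tensorRel {A B A' B' X : E} (R : A ⊗ B ⟶ Q.carrier) (R' : A' ⊗ B' ⟶ Q.carrier)
    (a : X ⟶ A ⊗ A') (b : X ⟶ B ⊗ B') :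
    ap (tensorRel R R') a b =
      Q.m (ap R (a ≫ fst _ _) (b ≫ fst _ _)) (ap R' (a ≫ snd _ _) (b ≫ snd _ _)) := by
  rw [ap, tensorRel, QuantaleData.comp_m, comp_ap, comp_ap]
  simp only [← Category.assoc, lift_fst, lift_snd]

lemma rel_ext {A B : E} {R S : A ⊗ B ⟶ Q.carrier}
    (h : ∀ (X : E) (a : X ⟶ A) (b : X ⟶ B), ap R a b = ap S a b) : R = S := by
  simpa [ap] using h _ (fst A B) (snd A B)

lemma idRel_eq_graphRel (A : E) : idRel Q A = graphRel Q (𝟙 A) := rfl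

open QuantaleData

variable [Q.IsCommQuantale]

lemma m_graphRel_le_iff {A B X : E} (f : A ⟶ B) (d : X ⟶ Q.carrier) (a : X ⟶ A) (b : X ⟶ B)
    (z : X ⟶ Q.carrier) :
    Q.Le (Q.m d (ap (graphRel Q f) a b)) z ↔ ∀ (T : E) (t : T ⟶ X), t ≫ a ≫ f = t ≫ b →
      Q.Le (t ≫ d) (t ≫ z) := by
  rw [ap, graphRel, m_join_le_iff]
  constructor
  · intro h T t ht
    have := h T t (t ≫ a) (by simp [comp_lift, ht])
    rwa [comp_one, m_one] at this
  · intro h T t i hi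
    have h1 := hi =≫ fst _ _
    have h2 := hi =≫ snd _ _
    simp at h1 h2
    rw [comp_one, m_one]
    exact h T t (by rw [← h2, h1, Category.assoc])

lemma m_compRel_le_iff {A B C X : E} (R : A ⊗ B ⟶ Q.carrier) (S : B ⊗ C ⟶ Q.carrier)
    (d : X ⟶ Q.carrier) (a : X ⟶ A) (c : X ⟶ C) (z : X ⟶ Q.carrier) :
    Q.Le (Q.m d (ap (compRel R S) a c)) z ↔ ∀ (T : E) (t : T ⟶ X) (b : T ⟶ B),
      Q.Le (Q.m (t ≫ d) (Q.m (ap R (t ≫ a) b) (ap S b (t ≫ c)))) (t ≫ z) := by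
  rw [ap, compRel, m_join_le_iff]
  constructor
  · intro h T t b
    have := h T t (lift (t ≫ a) (lift b (t ≫ c))) (by simp [comp_lift])
    rw [comp_m, comp_ap, comp_ap] at this
    simpa using this
  · intro h T t i hi
    have h1 := hi =≫ fst _ _
    have h2 := hi =≫ snd _ _
    simp at h1 h2
    rw [comp_m, comp_ap, comp_ap, h1, h2]
    exact h T t _

lemma compRel_le_iff {A B C X : E} (R : A ⊗ B ⟶ Q.carrier) (S : B ⊗ C ⟶ Q.carrier)
    (a : X ⟶ A) (c : X ⟶ C) (z : X ⟶ Q.carrier) :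
    Q.Le (ap (compRel R S) a c) z ↔ ∀ (T : E) (t : T ⟶ X) (b : T ⟶ B),
      Q.Le (Q.m (ap R (t ≫ a) b) (ap S b (t ≫ c))) (t ≫ z) := by
  have := m_compRel_le_iff R S (Q.one X) a c z
  simpa only [one_m, comp_one] using this

lemma graphRel_le_iff {A B X : E} (f : A ⟶ B) (a : X ⟶ A) (b : X ⟶ B) (z : X ⟶ Q.carrier) :
    Q.Le (ap (graphRel Q f) a b) z ↔ ∀ (T : E) (t : T ⟶ X), t ≫ a ≫ f = t ≫ b →
      Q.Le (Q.one T) (t ≫ z) := by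
  have := m_graphRel_le_iff f (Q.one X) a b z
  simpa only [one_m, comp_one] using this

lemma graphRel_compRel {A B C : E} (f : A ⟶ B) (R : B ⊗ C ⟶ Q.carrier) :
    compRel (graphRel Q f) R = (f ▷ C) ≫ R := by
  refine rel_ext fun X a c => eq_of_le_iff fun z => ?_
  have e : ap ((f ▷ C) ≫ R) a c = ap R (a ≫ f) c := by
    rw [ap, ← Category.assoc, lift_whiskerRight]; rfl
  rw [compRel_le_iff, e]
  constructor
  · intro h
    have := h X (𝟙 X) (a ≫ f)
    rw [m_comm, m_graphRel_le_iff] at this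
    simpa using this X (𝟙 X) (by simp)
  · intro h T t b
    rw [m_comm, m_graphRel_le_iff]
    intro T' t' ht'
    have := h.comp (t' ≫ t)
    rw [comp_ap] at this ⊢
    simp only [Category.assoc] at this ht' ⊢
    rwa [ht'] at this

/-- Postcomposition with the graph of an isomorphism. -/
lemma compRel_graphRel {A B C : E} (R : A ⊗ B ⟶ Q.carrier) (f : B ≅ C) :
    compRel R (graphRel Q f.hom) = (A ◁ f.inv) ≫ R := by
  refine rel_ext fun X a c => eq_of_le_iff fun z => ?_
  have e : ap ((A ◁ f.inv) ≫ R) a c = ap R a (c ≫ f.inv) := by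
    rw [ap, ← Category.assoc, lift_whiskerLeft]; rfl
  rw [compRel_le_iff, e]
  constructor
  · intro h
    have := h X (𝟙 X) (c ≫ f.inv)
    rw [m_graphRel_le_iff] at this
    simpa using this X (𝟙 X) (by simp)
  · intro h T t b
    rw [m_graphRel_le_iff]
    intro T' t' ht'
    have := h.comp (t' ≫ t)
    rw [comp_ap] at this ⊢
    rw [← Category.assoc, ← Iso.eq_comp_inv] at ht'
    simpa [ht'] using this

lemma id_compRel {A B : E} (R : A ⊗ B ⟶ Q.carrier) : compRel (idRel Q A) R = R := by
  rw [idRel_eq_graphRel, graphRel_compRel]; simp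

lemma compRel_id {A B : E} (R : A ⊗ B ⟶ Q.carrier) : compRel R (idRel Q B) = R := by
  have := compRel_graphRel R (Iso.refl B)
  simpa [idRel_eq_graphRel] using this

lemma compRel_assoc {A B C D : E} (R : A ⊗ B ⟶ Q.carrier) (S : B ⊗ C ⟶ Q.carrier)
    (T : C ⊗ D ⟶ Q.carrier) : compRel (compRel R S) T = compRel R (compRel S T) := by
  refine rel_ext fun X a d => eq_of_le_iff fun z => ?_
  rw [compRel_le_iff, compRel_le_iff]
  constructor
  · intro h T₁ t₁ b
    rw [m_compRel_le_iff]
    intro T₂ t₂ c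
    have := h T₂ (t₂ ≫ t₁) c
    rw [m_comm, m_compRel_le_iff] at this
    have := this T₂ (𝟙 _) (t₂ ≫ b)
    simp only [Category.id_comp, Category.assoc] at this
    rw [comp_ap]
    refine (Le.of_eq ?_).trans this
    ac_rfl
  · intro h T₁ t₁ c
    rw [m_comm, m_compRel_le_iff]
    intro T₂ t₂ b
    have := h T₂ (t₂ ≫ t₁) b
    rw [m_compRel_le_iff] at this
    have := this T₂ (𝟙 _) (t₂ ≫ c)
    simp only [Category.id_comp, Category.assoc] at this
    rw [comp_ap]
    refine (Le.of_eq ?_).trans this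
    ac_rfl

lemma graphRel_comp {A B C : E} (f : A ⟶ B) (g : B ⟶ C) :
    compRel (graphRel Q f) (graphRel Q g) = graphRel Q (f ≫ g) := by
  rw [graphRel_compRel]
  refine rel_ext fun X a c => eq_of_le_iff fun z => ?_
  have e : ap ((f ▷ C) ≫ graphRel Q g) a c = ap (graphRel Q g) (a ≫ f) c := by
    rw [ap, ← Category.assoc, lift_whiskerRight]; rfl
  rw [e, graphRel_le_iff, graphRel_le_iff]
  simp

lemma tensorRel_graphRel {A B A' B' : E} (f : A ⟶ B) (g : A' ⟶ B') :
    tensorRel (graphRel Q f) (graphRel Q g) = graphRel Q (f ⊗ₘ g) := by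
  refine rel_ext fun X a b => eq_of_le_iff fun z => ?_
  rw [ap_tensorRel, m_graphRel_le_iff, graphRel_le_iff]
  constructor
  · intro h T t ht
    have h1 := ht =≫ fst _ _
    have h2 := ht =≫ snd _ _
    simp at h1 h2
    have := h T t (by simpa using h2)
    rw [comp_ap, graphRel_le_iff] at this
    simpa using this T (𝟙 T) (by simpa using h1)
  · intro h T t ht
    rw [comp_ap, graphRel_le_iff]
    intro T' t' ht'
    have := h T' (t' ≫ t) (by
      ext
      · simpa using ht'
      · simpa using t' ≫= ht)
    simpa using this

lemma tensorRel_compRel {A B C A' B' C' : E} (R : A ⊗ B ⟶ Q.carrier) (S : B ⊗ C ⟶ Q.carrier)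
    (R' : A' ⊗ B' ⟶ Q.carrier) (S' : B' ⊗ C' ⟶ Q.carrier) :
    compRel (tensorRel R R') (tensorRel S S') = tensorRel (compRel R S) (compRel R' S') := by
  refine rel_ext fun X a c => eq_of_le_iff fun z => ?_
  rw [ap_tensorRel, compRel_le_iff, m_compRel_le_iff]
  constructor
  · intro h T₁ t₁ b'
    rw [comp_ap, m_comm, m_compRel_le_iff]
    intro T₂ t₂ b
    have := h T₂ (t₂ ≫ t₁) (lift b (t₂ ≫ b'))
    simp only [ap_tensorRel, comp_m, comp_ap, lift_fst, lift_snd, Category.assoc] at this ⊢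
    refine (Le.of_eq ?_).trans this
    ac_rfl
  · intro h T₁ t₁ b
    have := h T₁ t₁ (b ≫ snd _ _)
    rw [comp_ap, m_comm, m_compRel_le_iff] at this
    have := this T₁ (𝟙 _) (b ≫ fst _ _)
    simp only [ap_tensorRel, Category.id_comp, Category.assoc] at this ⊢
    refine (Le.of_eq ?_).trans this
    ac_rfl

end Relations

/-- Terms over the operation symbols `Op` with arities `ar`, in `n` variables. -/
inductive Term {Op : Type w} (ar : Op → ℕ) (n : ℕ) : Type w
  | var (i : Fin n) : Term ar n
  | app (σ : Op) (args : Fin (ar σ) → Term ar n) : Term ar n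

/-- An algebraic signature `(Σ, E)`: operation symbols of finite arity, and a set of equations
between terms, each in finitely many variables. -/
structure Signature where
  /-- the operation symbols -/
  Op : Type w
  /-- the arities -/
  arity : Op → ℕ
  /-- the equations -/
  eqs : ∀ n : ℕ, Set (Term arity n × Term arity n)

section Algebras

variable (S : Signature.{w}) {E : Type u} [Category.{v} E] [ElementaryTopos E]

/-- The value of a term at the generalized elements `ρ`, for operations `op` on `A`. -/
def Term.eval {S : Signature.{w}} {A : E} (op : ∀ σ : S.Op, (∏ᶜ fun _ : Fin (S.arity σ) => A) ⟶ A)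
    {n : ℕ} {X : E} (ρ : Fin n → (X ⟶ A)) : Term S.arity n → (X ⟶ A)
  | .var i => ρ i
  | .app σ args => Pi.lift (fun i => (args i).eval op ρ) ≫ op σ

variable (E) in
/-- A `(Σ, E)`-algebra in the topos `E`. -/
@[ext]
structure Algebra where
  /-- the underlying object -/
  carrier : E
  /-- the operations -/
  op : ∀ σ : S.Op, (∏ᶜ fun _ : Fin (S.arity σ) => carrier) ⟶ carrier
  /-- the equations hold, as equations between morphisms out of a power of the carrier -/
  eqs : ∀ (n : ℕ) (e : Term S.arity n × Term S.arity n), e ∈ S.eqs n →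
    e.1.eval op (fun i => Pi.π (fun _ : Fin n => carrier) i) =
      e.2.eval op (fun i => Pi.π (fun _ : Fin n => carrier) i)

variable {S}

lemma Term.comp_eval {A : E} (op : ∀ σ : S.Op, (∏ᶜ fun _ : Fin (S.arity σ) => A) ⟶ A)
    {n : ℕ} {X Y : E} (f : Y ⟶ X) (ρ : Fin n → (X ⟶ A)) (t : Term S.arity n) :
    f ≫ t.eval op ρ = t.eval op (fun i => f ≫ ρ i) := by
  induction t with
  | var i => rfl
  | app σ args ih =>
    simp only [Term.eval]
    rw [← Category.assoc]
    congr 1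
    ext i
    simp [ih]

/-- `f` is a homomorphism of algebras. -/
def Algebra.IsHom (A B : Algebra S E) (f : A.carrier ⟶ B.carrier) : Prop :=
  ∀ (σ : S.Op) (X : E) (a : Fin (S.arity σ) → (X ⟶ A.carrier)),
    Pi.lift a ≫ A.op σ ≫ f = Pi.lift (fun i => a i ≫ f) ≫ B.op σ

lemma Term.eval_hom {A B : E} {opA : ∀ σ : S.Op, (∏ᶜ fun _ : Fin (S.arity σ) => A) ⟶ A}
    {opB : ∀ σ : S.Op, (∏ᶜ fun _ : Fin (S.arity σ) => B) ⟶ B} (f : A ⟶ B)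
    (hf : ∀ (σ : S.Op) (X : E) (a : Fin (S.arity σ) → (X ⟶ A)),
      Pi.lift a ≫ opA σ ≫ f = Pi.lift (fun i => a i ≫ f) ≫ opB σ)
    {n : ℕ} {X : E} (ρ : Fin n → (X ⟶ A)) (t : Term S.arity n) :
    t.eval opA ρ ≫ f = t.eval opB (fun i => ρ i ≫ f) := by
  induction t with
  | var i => rfl
  | app σ args ih =>
    simp only [Term.eval, Category.assoc, hf, ih]

lemma Algebra.eval_eq (A : Algebra S E) {n : ℕ} {e : Term S.arity n × Term S.arity n}
    (he : e ∈ S.eqs n) {X : E} (ρ : Fin n → (X ⟶ A.carrier)) :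
    e.1.eval A.op ρ = e.2.eval A.op ρ := by
  have := Pi.lift ρ ≫= A.eqs n e he
  simpa [Term.comp_eval] using this

variable (S E) in
/-- The terminal algebra. -/
abbrev Algebra.unit : Algebra S E where
  carrier := 𝟙_ E
  op _ := toUnit _
  eqs _ _ _ := Subsingleton.elim _ _

/-- The product of two algebras. -/
abbrev Algebra.prod (A B : Algebra S E) : Algebra S E where
  carrier := A.carrier ⊗ B.carrier
  op σ := lift
    (Pi.lift (fun i => Pi.π (fun _ : Fin (S.arity σ) => A.carrier ⊗ B.carrier) i ≫ fst _ _) ≫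
      A.op σ)
    (Pi.lift (fun i => Pi.π (fun _ : Fin (S.arity σ) => A.carrier ⊗ B.carrier) i ≫ snd _ _) ≫
      B.op σ)
  eqs n e he := by
    have h1 := fun t : Term S.arity n => Term.eval_hom
      (opA := fun σ => lift
        (Pi.lift (fun i => Pi.π (fun _ : Fin (S.arity σ) => A.carrier ⊗ B.carrier) i ≫ fst _ _) ≫
          A.op σ)
        (Pi.lift (fun i => Pi.π (fun _ : Fin (S.arity σ) => A.carrier ⊗ B.carrier) i ≫ snd _ _) ≫
          B.op σ)) (opB := A.op) (fst A.carrier B.carrier)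
      (fun σ X a => by
        rw [lift_fst, ← Category.assoc]
        congr 1
        ext i
        simp) (fun i => Pi.π (fun _ : Fin n => A.carrier ⊗ B.carrier) i) t
    have h2 := fun t : Term S.arity n => Term.eval_hom
      (opA := fun σ => lift
        (Pi.lift (fun i => Pi.π (fun _ : Fin (S.arity σ) => A.carrier ⊗ B.carrier) i ≫ fst _ _) ≫
          A.op σ)
        (Pi.lift (fun i => Pi.π (fun _ : Fin (S.arity σ) => A.carrier ⊗ B.carrier) i ≫ snd _ _) ≫
          B.op σ)) (opB := B.op) (snd A.carrier B.carrier)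
      (fun σ X a => by
        rw [lift_snd, ← Category.assoc]
        congr 1
        ext i
        simp) (fun i => Pi.π (fun _ : Fin n => A.carrier ⊗ B.carrier) i) t
    ext
    · rw [h1, h1, A.eval_eq he]
    · rw [h2, h2, B.eval_eq he]

lemma Algebra.lift_prod_op_fst (A B : Algebra S E) (σ : S.Op) {X : E}
    (a : Fin (S.arity σ) → (X ⟶ (A.prod B).carrier)) :
    Pi.lift a ≫ (A.prod B).op σ ≫ fst A.carrier B.carrier =
      Pi.lift (fun i => a i ≫ fst A.carrier B.carrier) ≫ A.op σ := by
  simp only [Algebra.prod, lift_fst, ← Category.assoc]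
  congr 1
  ext i
  simp

lemma Algebra.lift_prod_op_snd (A B : Algebra S E) (σ : S.Op) {X : E}
    (a : Fin (S.arity σ) → (X ⟶ (A.prod B).carrier)) :
    Pi.lift a ≫ (A.prod B).op σ ≫ snd A.carrier B.carrier =
      Pi.lift (fun i => a i ≫ snd A.carrier B.carrier) ≫ B.op σ := by
  simp only [Algebra.prod, lift_snd, ← Category.assoc]
  congr 1
  ext i
  simp

lemma Algebra.isHom_id (A : Algebra S E) : A.IsHom A (𝟙 A.carrier) := by
  intro σ X a; simp

lemma Algebra.IsHom.comp {A B C : Algebra S E} {f : A.carrier ⟶ B.carrier}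
    {g : B.carrier ⟶ C.carrier} (hf : A.IsHom B f) (hg : B.IsHom C g) : A.IsHom C (f ≫ g) := by
  intro σ X a
  have h1 := hf σ X a =≫ g
  simp only [Category.assoc] at h1
  rw [h1, hg σ X]
  simp

lemma Algebra.isHom_fst (A B : Algebra S E) : (A.prod B).IsHom A (fst A.carrier B.carrier) :=
  fun σ _ a => A.lift_prod_op_fst B σ a

lemma Algebra.isHom_snd (A B : Algebra S E) : (A.prod B).IsHom B (snd A.carrier B.carrier) :=
  fun σ _ a => A.lift_prod_op_snd B σ a

lemma Algebra.isHom_toUnit (A : Algebra S E) : A.IsHom (Algebra.unit S E) (toUnit A.carrier) :=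
  fun _ _ _ => Subsingleton.elim (α := _ ⟶ 𝟙_ E) _ _

lemma Algebra.IsHom.lift {A B C : Algebra S E} {f : A.carrier ⟶ B.carrier}
    {g : A.carrier ⟶ C.carrier} (hf : A.IsHom B f) (hg : A.IsHom C g) :
    A.IsHom (B.prod C) (CartesianMonoidalCategory.lift f g) := by
  intro σ X a
  refine CartesianMonoidalCategory.hom_ext (X := B.carrier) (Y := C.carrier) _ _ ?_ ?_
  · rw [Category.assoc, Category.assoc, Category.assoc, lift_fst, lift_prod_op_fst, hf σ X]
    simp
  · rw [Category.assoc, Category.assoc, Category.assoc, lift_snd, lift_prod_op_snd, hg σ X]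
    simp

end Algebras

section AlgebraicRelations

variable {S : Signature.{w}} {E : Type u} [Category.{v} E] [ElementaryTopos E]

/-- The product `x₀ ⊗ ⋯ ⊗ xₙ₋₁`, which is the unit for `n = 0`. -/
def QuantaleData.prod (Q : QuantaleData E) {X : E} :
    ∀ {n : ℕ}, (Fin n → (X ⟶ Q.carrier)) → (X ⟶ Q.carrier)
  | 0, _ => Q.one X
  | _ + 1, x => Q.m (x 0) (Q.prod (fun i => x i.succ))

variable {Q : QuantaleData E}

/-- The relation `R` between algebras is algebraic: for each operation symbol `σ`,
`R(a₁, b₁) ⊗ ⋯ ⊗ R(aₙ, bₙ) ≤ R(σ(a₁, …, aₙ), σ(b₁, …, bₙ))`. -/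
def IsAlgebraic (A B : Algebra S E) (R : A.carrier ⊗ B.carrier ⟶ Q.carrier) : Prop :=
  ∀ (σ : S.Op) (X : E) (a : Fin (S.arity σ) → (X ⟶ A.carrier))
    (b : Fin (S.arity σ) → (X ⟶ B.carrier)),
    Q.Le (Q.prod fun i => ap R (a i) (b i)) (ap R (Pi.lift a ≫ A.op σ) (Pi.lift b ≫ B.op σ))

open QuantaleData

lemma comp_prod {X Y : E} (f : Y ⟶ X) {n : ℕ} (x : Fin n → (X ⟶ Q.carrier)) :
    f ≫ Q.prod x = Q.prod fun i => f ≫ x i := by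
  induction n with
  | zero => exact comp_one f
  | succ n ih => rw [QuantaleData.prod, comp_m, ih]; rfl

variable [Q.IsCommQuantale]


lemma m_prod_graphRel_le {A B X : E} (f : A ⟶ B) {n : ℕ} (a : Fin n → (X ⟶ A))
    (b : Fin n → (X ⟶ B)) (d z : X ⟶ Q.carrier)
    (h : ∀ (T : E) (t : T ⟶ X), (∀ i, t ≫ a i ≫ f = t ≫ b i) → Q.Le (t ≫ d) (t ≫ z)) :
    Q.Le (Q.m d (Q.prod fun i => ap (graphRel Q f) (a i) (b i))) z := by
  induction n generalizing X with
  | zero =>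
    rw [QuantaleData.prod, m_one]
    simpa using h X (𝟙 X) (fun i => i.elim0)
  | succ n ih =>
    rw [QuantaleData.prod, m_comm (ap _ _ _), ← IsQuantale.mul_assoc, m_graphRel_le_iff]
    intro T t ht
    rw [comp_m, comp_prod]
    simp only [comp_ap]
    refine ih _ _ _ _ fun T' t' ht' => ?_
    have := h T' (t' ≫ t) (fun i => by
      refine Fin.cases ?_ (fun j => ?_) i
      · simpa using t' ≫= ht
      · simpa using ht' j)
    simpa using this

lemma m_prod_compRel_le {A B C X : E} (R : A ⊗ B ⟶ Q.carrier) (R' : B ⊗ C ⟶ Q.carrier) {n : ℕ}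
    (a : Fin n → (X ⟶ A)) (c : Fin n → (X ⟶ C)) (d z : X ⟶ Q.carrier)
    (h : ∀ (T : E) (t : T ⟶ X) (b : Fin n → (T ⟶ B)),
      Q.Le (Q.m (t ≫ d) (Q.m (Q.prod fun i => ap R (t ≫ a i) (b i))
        (Q.prod fun i => ap R' (b i) (t ≫ c i)))) (t ≫ z)) :
    Q.Le (Q.m d (Q.prod fun i => ap (compRel R R') (a i) (c i))) z := by
  induction n generalizing X with
  | zero =>
    have := h X (𝟙 X) (fun i => i.elim0)
    simp only [QuantaleData.prod, m_one, Category.id_comp] at this ⊢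
    exact this
  | succ n ih =>
    rw [QuantaleData.prod, m_comm (ap _ _ _), ← IsQuantale.mul_assoc, m_compRel_le_iff]
    intro T t b₀
    rw [comp_m, comp_prod]
    simp only [comp_ap]
    have e : ∀ p q r : T ⟶ Q.carrier, Q.m (Q.m p q) r = Q.m (Q.m p r) q := by
      intro p q r; ac_rfl
    rw [e]
    refine ih _ _ _ _ fun T' t' b => ?_
    have := h T' (t' ≫ t) (Fin.cons (t' ≫ b₀) b)
    simp only [QuantaleData.prod, Fin.cons_zero, Fin.cons_succ, comp_m, comp_ap,
      Category.assoc] at this ⊢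
    refine (Le.of_eq ?_).trans this
    ac_rfl

lemma prod_m {X : E} {n : ℕ} (x y : Fin n → (X ⟶ Q.carrier)) :
    Q.prod (fun i => Q.m (x i) (y i)) = Q.m (Q.prod x) (Q.prod y) := by
  induction n with
  | zero => simp only [QuantaleData.prod, m_one]
  | succ n ih =>
    simp only [QuantaleData.prod, ih]
    ac_rfl

lemma IsAlgebraic.graph {A B : Algebra S E} {f : A.carrier ⟶ B.carrier} (hf : A.IsHom B f) :
    IsAlgebraic A B (graphRel Q f) := by
  intro σ X a b
  have := m_prod_graphRel_le (Q := Q) f a b (Q.one X)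
    (ap (graphRel Q f) (Pi.lift a ≫ A.op σ) (Pi.lift b ≫ B.op σ)) (fun T t ht => by
      have h1 := (graphRel_le_iff (Q := Q) f (t ≫ Pi.lift a ≫ A.op σ) (t ≫ Pi.lift b ≫ B.op σ) _).1
        (le_refl _) T (𝟙 T) (by
          rw [Category.assoc, Category.assoc, hf σ X]
          simp only [← Category.assoc]
          congr 1
          ext i
          simpa using ht i)
      rw [comp_one, comp_ap]
      simpa using h1)
  rwa [one_m] at this

lemma IsAlgebraic.id (A : Algebra S E) : IsAlgebraic A A (idRel Q A.carrier) :=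
  IsAlgebraic.graph A.isHom_id

lemma IsAlgebraic.comp {A B C : Algebra S E} {R : A.carrier ⊗ B.carrier ⟶ Q.carrier}
    {R' : B.carrier ⊗ C.carrier ⟶ Q.carrier} (h : IsAlgebraic A B R) (h' : IsAlgebraic B C R') :
    IsAlgebraic A C (compRel R R') := by
  intro σ X a c
  have := m_prod_compRel_le R R' a c (Q.one X)
    (ap (compRel R R') (Pi.lift a ≫ A.op σ) (Pi.lift c ≫ C.op σ)) (fun T t b => by
      have h1 := (compRel_le_iff R R' (t ≫ Pi.lift a ≫ A.op σ) (t ≫ Pi.lift c ≫ C.op σ) _).1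
        (le_refl _) T (𝟙 T) (Pi.lift b ≫ B.op σ)
      rw [comp_one, one_m, comp_ap]
      simp only [Category.id_comp] at h1
      refine (m_mono (h σ T (fun i => t ≫ a i) b) (h' σ T b (fun i => t ≫ c i))).trans ?_
      refine (Le.of_eq ?_).trans h1
      have e : ∀ {Z : E} {n : ℕ} (x : Fin n → (X ⟶ Z)),
          t ≫ Pi.lift x = Pi.lift (fun i => t ≫ x i) := by
        intro Z n x; ext i; simp
      rw [← Category.assoc, ← Category.assoc t, e, e])
  rwa [one_m] at this

lemma IsAlgebraic.tensor {A B A' B' : Algebra S E} {R : A.carrier ⊗ B.carrier ⟶ Q.carrier}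
    {R' : A'.carrier ⊗ B'.carrier ⟶ Q.carrier} (h : IsAlgebraic A B R) (h' : IsAlgebraic A' B' R') :
    IsAlgebraic (A.prod A') (B.prod B') (tensorRel R R') := by
  intro σ X a b
  rw [ap_tensorRel,
    (Category.assoc _ _ _).trans (A.lift_prod_op_fst A' σ a),
    (Category.assoc _ _ _).trans (A.lift_prod_op_snd A' σ a),
    (Category.assoc _ _ _).trans (B.lift_prod_op_fst B' σ b),
    (Category.assoc _ _ _).trans (B.lift_prod_op_snd B' σ b)]
  simp only [ap_tensorRel, prod_m]
  exact m_mono (h σ X _ _) (h' σ X _ _)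

end AlgebraicRelations

section Coherence

variable {E : Type u} [Category.{v} E] [ElementaryTopos E] {Q : QuantaleData E}
  [Q.IsCommQuantale]

open QuantaleData

/-- The exchange of factors. -/
@[simps]
def swapIso (A B : E) : A ⊗ B ≅ B ⊗ A where
  hom := lift (snd A B) (fst A B)
  inv := lift (snd B A) (fst B A)

lemma tensorRel_id (A B : E) : tensorRel (idRel Q A) (idRel Q B) = idRel Q (A ⊗ B) := by
  simp only [idRel_eq_graphRel]
  rw [tensorRel_graphRel, id_tensorHom_id]

lemma ap_whiskerRight {A B C X : E} (f : A ⟶ B) (R : B ⊗ C ⟶ Q.carrier) (a : X ⟶ A)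
    (c : X ⟶ C) : ap ((f ▷ C) ≫ R) a c = ap R (a ≫ f) c := by
  rw [ap, ← Category.assoc, lift_whiskerRight]; rfl

lemma ap_whiskerLeft {A B C X : E} (f : B ⟶ C) (R : A ⊗ C ⟶ Q.carrier) (a : X ⟶ A)
    (b : X ⟶ B) : ap ((A ◁ f) ≫ R) a b = ap R a (b ≫ f) := by
  rw [ap, ← Category.assoc, lift_whiskerLeft]; rfl

lemma ap_idRel_unit {X : E} (a b : X ⟶ 𝟙_ E) : ap (idRel Q (𝟙_ E)) a b = Q.one X := by
  refine eq_of_le_iff fun z => ?_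
  rw [idRel_eq_graphRel, graphRel_le_iff]
  constructor
  · intro h
    simpa using h X (𝟙 X) (Subsingleton.elim _ _)
  · intro h T t _
    have := h.comp t
    rwa [comp_one] at this

lemma associatorRel_naturality {A₁ A₂ A₃ B₁ B₂ B₃ : E} (R₁ : A₁ ⊗ B₁ ⟶ Q.carrier)
    (R₂ : A₂ ⊗ B₂ ⟶ Q.carrier) (R₃ : A₃ ⊗ B₃ ⟶ Q.carrier) :
    compRel (tensorRel (tensorRel R₁ R₂) R₃) (graphRel Q (α_ B₁ B₂ B₃).hom) =
      compRel (graphRel Q (α_ A₁ A₂ A₃).hom) (tensorRel R₁ (tensorRel R₂ R₃)) := by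
  rw [graphRel_compRel, compRel_graphRel]
  refine rel_ext fun X a b => ?_
  simp only [ap_whiskerLeft, ap_whiskerRight, ap_tensorRel, Category.assoc, associator_inv_fst_fst,
    associator_inv_fst_snd, associator_inv_snd, associator_hom_fst, associator_hom_snd_fst,
    associator_hom_snd_snd]
  ac_rfl

lemma leftUnitorRel_naturality {A B : E} (R : A ⊗ B ⟶ Q.carrier) :
    compRel (tensorRel (idRel Q (𝟙_ E)) R) (graphRel Q (λ_ B).hom) =
      compRel (graphRel Q (λ_ A).hom) R := by
  rw [graphRel_compRel, compRel_graphRel]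
  refine rel_ext fun X a b => ?_
  simp only [ap_whiskerLeft, ap_whiskerRight, ap_tensorRel, ap_idRel_unit, one_m, Category.assoc,
    leftUnitor_inv_snd, leftUnitor_hom, Category.comp_id]

lemma rightUnitorRel_naturality {A B : E} (R : A ⊗ B ⟶ Q.carrier) :
    compRel (tensorRel R (idRel Q (𝟙_ E))) (graphRel Q (ρ_ B).hom) =
      compRel (graphRel Q (ρ_ A).hom) R := by
  rw [graphRel_compRel, compRel_graphRel]
  refine rel_ext fun X a b => ?_
  simp only [ap_whiskerLeft, ap_whiskerRight, ap_tensorRel, ap_idRel_unit, m_one, Category.assoc,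
    rightUnitor_inv_fst, rightUnitor_hom, Category.comp_id]

lemma swapRel_naturality {A A' B B' : E} (R : A ⊗ B ⟶ Q.carrier) (R' : A' ⊗ B' ⟶ Q.carrier) :
    compRel (tensorRel R R') (graphRel Q (swapIso B B').hom) =
      compRel (graphRel Q (swapIso A A').hom) (tensorRel R' R) := by
  rw [graphRel_compRel, compRel_graphRel]
  refine rel_ext fun X a b => ?_
  simp only [ap_whiskerLeft, ap_whiskerRight, ap_tensorRel, Category.assoc, swapIso_hom,
    swapIso_inv, lift_fst, lift_snd]
  ac_rfl

lemma pentagonRel (A B C D : E) :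
    compRel (tensorRel (graphRel Q (α_ A B C).hom) (idRel Q D))
      (compRel (graphRel Q (α_ A (B ⊗ C) D).hom)
        (tensorRel (idRel Q A) (graphRel Q (α_ B C D).hom))) =
      compRel (graphRel Q (α_ (A ⊗ B) C D).hom) (graphRel Q (α_ A B (C ⊗ D)).hom) := by
  simp only [idRel_eq_graphRel, tensorRel_graphRel, graphRel_comp, tensorHom_id, id_tensorHom,
    MonoidalCategory.pentagon]

lemma triangleRel (A B : E) :
    compRel (graphRel Q (α_ A (𝟙_ E) B).hom) (tensorRel (idRel Q A) (graphRel Q (λ_ B).hom)) =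
      tensorRel (graphRel Q (ρ_ A).hom) (idRel Q B) := by
  simp only [idRel_eq_graphRel, tensorRel_graphRel, graphRel_comp, tensorHom_id, id_tensorHom,
    MonoidalCategory.triangle]

lemma hexagonRel_forward (A B C : E) :
    compRel (graphRel Q (α_ A B C).hom) (compRel (graphRel Q (swapIso A (B ⊗ C)).hom)
      (graphRel Q (α_ B C A).hom)) =
    compRel (tensorRel (graphRel Q (swapIso A B).hom) (idRel Q C))
      (compRel (graphRel Q (α_ B A C).hom)
        (tensorRel (idRel Q B) (graphRel Q (swapIso A C).hom))) := by
  simp only [idRel_eq_graphRel, tensorRel_graphRel, graphRel_comp]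
  congr 1
  ext <;> simp

lemma hexagonRel_reverse (A B C : E) :
    compRel (graphRel Q (α_ A B C).inv) (compRel (graphRel Q (swapIso (A ⊗ B) C).hom)
      (graphRel Q (α_ C A B).inv)) =
    compRel (tensorRel (idRel Q A) (graphRel Q (swapIso B C).hom))
      (compRel (graphRel Q (α_ A C B).inv)
        (tensorRel (graphRel Q (swapIso A C).hom) (idRel Q B))) := by
  simp only [idRel_eq_graphRel, tensorRel_graphRel, graphRel_comp]
  congr 1
  ext <;> simp

lemma swapRel_symmetry (A B : E) :
    compRel (graphRel Q (swapIso A B).hom) (graphRel Q (swapIso B A).hom) =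
      idRel Q (A ⊗ B) := by
  rw [idRel_eq_graphRel, graphRel_comp]
  congr 1
  ext <;> simp

end Coherence

section RelCategory

variable (S : Signature.{w}) {E : Type u} [Category.{v} E] [ElementaryTopos E]
  (Q : QuantaleData E)

/-- The objects of the category of algebraic `Q`-relations: `(Σ, E)`-algebras. -/
@[ext]
structure Rel (S : Signature.{w}) {E : Type u} [Category.{v} E] [ElementaryTopos E]
    (Q : QuantaleData E) where
  /-- the underlying algebra -/
  alg : Algebra S E

variable {S Q}

/-- The morphisms of the category of algebraic `Q`-relations. -/
@[ext]
structure Rel.Hom (A B : Rel S Q) where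
  /-- the underlying `Q`-relation -/
  rel : A.alg.carrier ⊗ B.alg.carrier ⟶ Q.carrier
  /-- the relation is algebraic -/
  algebraic : IsAlgebraic A.alg B.alg rel

variable [Q.IsCommQuantale]

namespace Rel

instance : Category (Rel S Q) where
  Hom := Rel.Hom
  id A := ⟨idRel Q A.alg.carrier, IsAlgebraic.id A.alg⟩
  comp R R' := ⟨compRel R.rel R'.rel, R.algebraic.comp R'.algebraic⟩
  id_comp R := Rel.Hom.ext (id_compRel R.rel)
  comp_id R := Rel.Hom.ext (compRel_id R.rel)
  assoc R R' R'' := Rel.Hom.ext (compRel_assoc R.rel R'.rel R''.rel)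

/-- The underlying `Q`-relation of a morphism. -/
abbrev rel {A B : Rel S Q} (R : A ⟶ B) : A.alg.carrier ⊗ B.alg.carrier ⟶ Q.carrier :=
  Rel.Hom.rel R

@[ext]
lemma hom_ext {A B : Rel S Q} {R R' : A ⟶ B} (h : rel R = rel R') : R = R' := Rel.Hom.ext h

lemma rel_id (A : Rel S Q) : rel (𝟙 A) = idRel Q A.alg.carrier := rfl
lemma rel_comp {A B C : Rel S Q} (R : A ⟶ B) (R' : B ⟶ C) :
    rel (R ≫ R') = compRel (rel R) (rel R') := rfl

/-- The graph of an isomorphism of algebras, as an isomorphism. -/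
def graphIso {A B : Rel S Q} (f : A.alg.carrier ≅ B.alg.carrier) (h : A.alg.IsHom B.alg f.hom)
    (h' : B.alg.IsHom A.alg f.inv) : A ≅ B where
  hom := ⟨graphRel Q f.hom, IsAlgebraic.graph h⟩
  inv := ⟨graphRel Q f.inv, IsAlgebraic.graph h'⟩
  hom_inv_id := by
    apply hom_ext
    change compRel (graphRel Q f.hom) (graphRel Q f.inv) = graphRel Q (𝟙 _)
    rw [graphRel_comp, f.hom_inv_id]
  inv_hom_id := by
    apply hom_ext
    change compRel (graphRel Q f.inv) (graphRel Q f.hom) = graphRel Q (𝟙 _)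
    rw [graphRel_comp, f.inv_hom_id]

lemma isHom_assoc_hom (A B C : Algebra S E) :
    ((A.prod B).prod C).IsHom (A.prod (B.prod C))
      (α_ A.carrier B.carrier C.carrier).hom := by
  have e : (α_ A.carrier B.carrier C.carrier).hom =
      lift (fst _ _ ≫ fst _ _) (lift (fst _ _ ≫ snd _ _) (snd _ _)) := by
    ext <;> simp
  rw [e]
  have h1 := Algebra.isHom_fst (A.prod B) C
  exact (h1.comp (Algebra.isHom_fst A B)).lift
    ((h1.comp (Algebra.isHom_snd A B)).lift (Algebra.isHom_snd (A.prod B) C))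

lemma isHom_assoc_inv (A B C : Algebra S E) :
    (A.prod (B.prod C)).IsHom ((A.prod B).prod C)
      (α_ A.carrier B.carrier C.carrier).inv := by
  have e : (α_ A.carrier B.carrier C.carrier).inv =
      lift (lift (fst _ _) (snd _ _ ≫ fst _ _)) (snd _ _ ≫ snd _ _) := by
    ext <;> simp
  rw [e]
  have h1 := Algebra.isHom_snd A (B.prod C)
  exact ((Algebra.isHom_fst A (B.prod C)).lift (h1.comp (Algebra.isHom_fst B C))).lift
    (h1.comp (Algebra.isHom_snd B C))

lemma isHom_swap (A B : Algebra S E) :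
    (A.prod B).IsHom (B.prod A) (lift (snd A.carrier B.carrier) (fst A.carrier B.carrier)) :=
  (Algebra.isHom_snd A B).lift (Algebra.isHom_fst A B)

instance : MonoidalCategoryStruct (Rel S Q) where
  tensorObj A B := ⟨A.alg.prod B.alg⟩
  tensorUnit := ⟨Algebra.unit S E⟩
  tensorHom R R' := ⟨tensorRel R.rel R'.rel, R.algebraic.tensor R'.algebraic⟩
  whiskerLeft A _ _ R := ⟨tensorRel (idRel Q A.alg.carrier) R.rel,
    (IsAlgebraic.id A.alg).tensor R.algebraic⟩
  whiskerRight R A := ⟨tensorRel R.rel (idRel Q A.alg.carrier),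
    R.algebraic.tensor (IsAlgebraic.id A.alg)⟩
  associator A B C := graphIso (α_ A.alg.carrier B.alg.carrier C.alg.carrier)
    (isHom_assoc_hom _ _ _) (isHom_assoc_inv _ _ _)
  leftUnitor A := graphIso (λ_ A.alg.carrier)
    (by rw [leftUnitor_hom]; exact Algebra.isHom_snd (Algebra.unit S E) A.alg)
    (by
      have e : (λ_ A.alg.carrier).inv = lift (toUnit _) (𝟙 _) := by ext <;> simp
      rw [e]
      exact (Algebra.isHom_toUnit A.alg).lift A.alg.isHom_id)
  rightUnitor A := graphIso (ρ_ A.alg.carrier)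
    (by rw [rightUnitor_hom]; exact Algebra.isHom_fst A.alg (Algebra.unit S E))
    (by
      have e : (ρ_ A.alg.carrier).inv = lift (𝟙 _) (toUnit _) := by ext <;> simp
      rw [e]
      exact A.alg.isHom_id.lift (Algebra.isHom_toUnit A.alg))

instance : MonoidalCategory (Rel S Q) := MonoidalCategory.ofTensorHom
  (id_tensorHom_id := fun _ _ => hom_ext (tensorRel_id _ _))
  (id_tensorHom := fun _ _ _ _ => rfl)
  (tensorHom_id := fun _ _ => rfl)
  (tensorHom_comp_tensorHom := fun _ _ _ _ => hom_ext (tensorRel_compRel _ _ _ _))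
  (associator_naturality := fun _ _ _ => hom_ext (associatorRel_naturality _ _ _))
  (leftUnitor_naturality := fun _ => hom_ext (leftUnitorRel_naturality _))
  (rightUnitor_naturality := fun _ => hom_ext (rightUnitorRel_naturality _))
  (pentagon := fun _ _ _ _ => hom_ext (pentagonRel _ _ _ _))
  (triangle := fun _ _ => hom_ext (triangleRel _ _))

instance : SymmetricCategory (Rel S Q) where
  braiding A B := graphIso (swapIso A.alg.carrier B.alg.carrier) (isHom_swap _ _) (isHom_swap _ _)
  braiding_naturality_right A _ _ R := hom_ext (swapRel_naturality (idRel Q A.alg.carrier) R.rel)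
  braiding_naturality_left R A := hom_ext (swapRel_naturality R.rel (idRel Q A.alg.carrier))
  hexagon_forward _ _ _ := hom_ext (hexagonRel_forward _ _ _)
  hexagon_reverse _ _ _ := hom_ext (hexagonRel_reverse _ _ _)
  symmetry _ _ := hom_ext (swapRel_symmetry _ _)

end Rel

end RelCategory

section LogicalFunctors

/-- The morphism `t` is a subobject classifier: a monomorphism such that every monomorphism is the
pullback of `t` along a unique morphism. -/
def IsClassifier {F : Type u} [Category.{v} F] {Ω₀ Ω : F} (t : Ω₀ ⟶ Ω) : Prop :=
  Mono t ∧ ∀ {U X : F} (m : U ⟶ X) [Mono m],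
    ∃! c : X ⟶ Ω, ∃ c₀ : U ⟶ Ω₀, IsPullback m c₀ c t

lemma isClassifier_truth (F : Type u) [Category.{v} F] [HasSubobjectClassifier F] :
    IsClassifier (truth F) := by
  refine ⟨inferInstance, fun m hm => ⟨χ m, ⟨_, isPullback_χ m⟩, ?_⟩⟩
  rintro c ⟨c₀, hc⟩
  exact Subobject.Classifier.uniq _ m hc

lemma IsClassifier.of_iso {F : Type u} [Category.{v} F] {Ω₀ Ω Ω₀' Ω' : F} {t : Ω₀ ⟶ Ω}
    {t' : Ω₀' ⟶ Ω'} (h : IsClassifier t) (e₀ : Ω₀ ≅ Ω₀') (e : Ω ≅ Ω')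
    (w : t ≫ e.hom = e₀.hom ≫ t') : IsClassifier t' := by
  have := h.1
  have ht' : t' = e₀.inv ≫ t ≫ e.hom := by rw [w, Iso.inv_hom_id_assoc]
  have sq : IsPullback t e₀.hom e.hom t' := IsPullback.of_vert_isIso ⟨w⟩
  have sq' : IsPullback t' e₀.inv e.inv t := IsPullback.of_vert_isIso ⟨by rw [ht']; simp⟩
  refine ⟨by rw [ht']; infer_instance, fun m hm => ?_⟩
  obtain ⟨c, ⟨c₀, hc⟩, hu⟩ := h.2 m
  refine ⟨c ≫ e.hom, ⟨_, hc.paste_vert sq⟩, ?_⟩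
  rintro d ⟨d₀, hd⟩
  rw [← hu (d ≫ e.inv) ⟨_, hd.paste_vert sq'⟩]
  simp

/-- The comparison `L (B ^ A) ⟶ (L B) ^ (L A)` of exponentials: the transpose of
`L A ⊗ L (B ^ A) ≅ L (A ⊗ B ^ A) ⟶ L B`. -/
def expHom {E : Type u₁} [Category.{v₁} E] [ElementaryTopos E] {F : Type u₂} [Category.{v₂} F]
    [ElementaryTopos F] (L : E ⥤ F) [PreservesFiniteProducts L] (A B : E) :
    L.obj ((ihom A).obj B) ⟶ (ihom (L.obj A)).obj (L.obj B) :=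
  MonoidalClosed.curry (inv (prodComparison L A ((ihom A).obj B)) ≫ L.map ((ihom.ev A).app B))

/-- A logical functor between toposes: it preserves finite products, exponentials and the
subobject classifier. -/
class IsLogical {E : Type u₁} [Category.{v₁} E] [ElementaryTopos E] {F : Type u₂} [Category.{v₂} F]
    [ElementaryTopos F] (L : E ⥤ F) : Prop extends
    PreservesFiniteProducts L where
  isIso_expHom : ∀ A B : E, IsIso (expHom L A B)
  isClassifier : IsClassifier (L.map (truth E))

variable {E : Type u₁} [Category.{v₁} E] [ElementaryTopos E] {F : Type u₂} [Category.{v₂} F]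
  [ElementaryTopos F] {G : Type u₃} [Category.{v₃} G] [ElementaryTopos G]

section

variable (L : E ⥤ F) [IsLogical L]

instance : Mono (L.map (truth E)) := (IsLogical.isClassifier (L := L)).1

/-- The comparison of the objects of truth values. -/
def omegaHom : L.obj (Ω E) ⟶ Ω F := χ (L.map (truth E))

instance : IsIso (omegaHom L) := by
  obtain ⟨d, ⟨d₀, hd⟩, -⟩ := (IsLogical.isClassifier (L := L)).2 (truth F)
  have hc : IsPullback (L.map (truth E)) _ (omegaHom L) (truth F) :=
    isPullback_χ (L.map (truth E))
  obtain ⟨r, -, hr⟩ := (IsLogical.isClassifier (L := L)).2 (L.map (truth E))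
  refine ⟨d, ?_, ?_⟩
  · rw [hr _ ⟨_, hc.paste_vert hd⟩, hr (𝟙 _) ⟨𝟙 _, IsPullback.of_vert_isIso ⟨by simp⟩⟩]
  · rw [Subobject.Classifier.uniq _ _ (hd.paste_vert hc)]
    exact (Subobject.Classifier.uniq _ _
      (IsPullback.of_vert_isIso ⟨by simp⟩ : IsPullback (truth F) (𝟙 _) (𝟙 _) (truth F))).symm

/-- The comparison of power objects. -/
def powHom (A : E) : L.obj (Pow A) ⟶ Pow (L.obj A) :=
  expHom L A (Ω E) ≫ (ihom (L.obj A)).map (omegaHom L)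

instance (A : E) : IsIso (powHom L A) := by
  have := IsLogical.isIso_expHom (L := L) A (Ω E)
  unfold powHom
  infer_instance

lemma map_tt (X : E) : L.map (tt X) ≫ omegaHom L = tt (L.obj X) := by
  unfold tt omegaHom
  rw [L.map_comp, Category.assoc, HasSubobjectClassifier.comm, ← Category.assoc]
  congr 1
  exact Subsingleton.elim _ _

end

lemma expHom_id (A B : E) : expHom (𝟭 E) A B = 𝟙 ((ihom A).obj B) := by
  apply MonoidalClosed.uncurry_injective
  unfold expHom
  rw [MonoidalClosed.uncurry_curry]
  erw [MonoidalClosed.uncurry_id_eq_ev, IsIso.inv_comp_eq, prodComparison_id, Category.id_comp]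
  rfl

instance : IsLogical (𝟭 E) where
  isIso_expHom A B := by rw [expHom_id]; exact IsIso.id _
  isClassifier := isClassifier_truth E

lemma omegaHom_id : omegaHom (𝟭 E) = 𝟙 (Ω E) :=
  (Subobject.Classifier.uniq _ _
      (IsPullback.of_vert_isIso ⟨by simp⟩ : IsPullback (truth E) (𝟙 _) (𝟙 _) (truth E))).symm

lemma powHom_id (A : E) : powHom (𝟭 E) A = 𝟙 (Pow A) := by
  unfold powHom
  rw [expHom_id, omegaHom_id]
  exact (Category.id_comp _).trans ((ihom A).map_id _)

lemma uncurry_expHom (L : E ⥤ F) [PreservesFiniteProducts L] (A B : E) :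
    MonoidalClosed.uncurry (expHom L A B) =
      inv (prodComparison L A ((ihom A).obj B)) ≫ L.map ((ihom.ev A).app B) :=
  MonoidalClosed.uncurry_curry _

lemma whiskerLeft_comp_inv_prodComparison (L : E ⥤ F) [PreservesFiniteProducts L] (A : E)
    {B C : E} (f : B ⟶ C) :
    L.obj A ◁ L.map f ≫ inv (prodComparison L A C) =
      inv (prodComparison L A B) ≫ L.map (A ◁ f) := by
  rw [IsIso.comp_inv_eq, Category.assoc, prodComparison_natural_whiskerLeft,
    IsIso.inv_hom_id_assoc]

lemma inv_eq_of_eq_map_comp (K : F ⥤ G) {a b : F} {c : G} (f : a ⟶ b) [IsIso f]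
    (g : K.obj b ⟶ c) [IsIso g] (h : K.obj a ⟶ c) [IsIso h] (w : h = K.map f ≫ g) :
    inv h = inv g ≫ K.map (inv f) := by
  subst w
  simp

lemma inv_eq_id {A : E} (f : A ⟶ A) [IsIso f] (w : f = 𝟙 A) : inv f = 𝟙 A := by
  subst w
  simp

lemma inv_prodComparison_comp (L : E ⥤ F) (K : F ⥤ G) [PreservesFiniteProducts L]
    [PreservesFiniteProducts K] (A B : E) :
    inv (prodComparison (L ⋙ K) A B) =
      inv (prodComparison K (L.obj A) (L.obj B)) ≫ K.map (inv (prodComparison L A B)) := by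
  exact inv_eq_of_eq_map_comp K (prodComparison L A B)
    (prodComparison K (L.obj A) (L.obj B)) (prodComparison (L ⋙ K) A B) (prodComparison_comp L K)

lemma expHom_comp (L : E ⥤ F) (K : F ⥤ G) [PreservesFiniteProducts L] [PreservesFiniteProducts K]
    (A B : E) :
    expHom (L ⋙ K) A B = K.map (expHom L A B) ≫ expHom K (L.obj A) (L.obj B) := by
  apply MonoidalClosed.uncurry_injective
  have h1 := whiskerLeft_comp_inv_prodComparison K (L.obj A) (expHom L A B)
  have h2 := uncurry_expHom L A B
  rw [MonoidalClosed.uncurry_eq] at h2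
  have h3 : MonoidalClosed.uncurry (K.map (expHom L A B) ≫ expHom K (L.obj A) (L.obj B)) =
      inv (prodComparison K (L.obj A) (L.obj ((ihom A).obj B))) ≫
        K.map (inv (prodComparison L A ((ihom A).obj B)) ≫ L.map ((ihom.ev A).app B)) := by
    rw [MonoidalClosed.uncurry_natural_left, uncurry_expHom, ← Category.assoc, h1, Category.assoc,
      ← K.map_comp, h2]
  rw [uncurry_expHom, inv_prodComparison_comp]
  refine Eq.trans ?_ h3.symm
  rw [K.map_comp, Category.assoc]
  rfl

lemma expHom_naturality (L : E ⥤ F) [PreservesFiniteProducts L] (A : E) {B C : E} (f : B ⟶ C) :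
    L.map ((ihom A).map f) ≫ expHom L A C =
      expHom L A B ≫ (ihom (L.obj A)).map (L.map f) := by
  apply MonoidalClosed.uncurry_injective
  rw [MonoidalClosed.uncurry_natural_left, MonoidalClosed.uncurry_natural_right, uncurry_expHom,
    uncurry_expHom, ← Category.assoc, whiskerLeft_comp_inv_prodComparison, Category.assoc,
    Category.assoc, ← L.map_comp, ← L.map_comp, ihom.ev_naturality]

lemma isPullback_map_truth (L : E ⥤ F) (K : F ⥤ G) [IsLogical L] [IsLogical K] :
    ∃ e : K.obj (L.obj (Ω₀ E)) ≅ K.obj (Ω₀ F),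
      K.map (L.map (truth E)) ≫ K.map (omegaHom L) = e.hom ≫ K.map (truth F) := by
  have hc : IsPullback (L.map (truth E)) _ (omegaHom L) (truth F) :=
    isPullback_χ (L.map (truth E))
  have := hc.isIso_snd_of_isIso
  exact ⟨K.mapIso (asIso (Subobject.Classifier.χ₀ _ (L.obj (Ω₀ E)))), by
    rw [← K.map_comp, hc.w, K.map_comp]; rfl⟩

instance (L : E ⥤ F) (K : F ⥤ G) [IsLogical L] [IsLogical K] : IsLogical (L ⋙ K) where
  isIso_expHom A B := by
    have := IsLogical.isIso_expHom (L := L) A B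
    have := IsLogical.isIso_expHom (L := K) (L.obj A) (L.obj B)
    rw [expHom_comp]
    infer_instance
  isClassifier := by
    obtain ⟨e, he⟩ := isPullback_map_truth L K
    refine (IsLogical.isClassifier (L := K)).of_iso e.symm (K.mapIso (asIso (omegaHom L))).symm ?_
    simp only [Iso.symm_hom, Functor.mapIso_inv, asIso_inv]
    rw [Iso.eq_inv_comp, ← Category.assoc, ← he, Category.assoc, ← K.map_comp]
    simp

lemma omegaHom_comp (L : E ⥤ F) (K : F ⥤ G) [IsLogical L] [IsLogical K] :
    omegaHom (L ⋙ K) = K.map (omegaHom L) ≫ omegaHom K := by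
  obtain ⟨e, he⟩ := isPullback_map_truth L K
  have h1 : IsPullback (K.map (L.map (truth E))) e.hom (K.map (omegaHom L)) (K.map (truth F)) :=
    IsPullback.of_vert_isIso ⟨he⟩
  exact (Subobject.Classifier.uniq _ ((L ⋙ K).map (truth E))
    (h1.paste_vert (isPullback_χ (K.map (truth F))))).symm

lemma powHom_comp (L : E ⥤ F) (K : F ⥤ G) [IsLogical L] [IsLogical K] (A : E) :
    powHom (L ⋙ K) A = K.map (powHom L A) ≫ powHom K (L.obj A) := by
  unfold powHom
  rw [expHom_comp, omegaHom_comp, K.map_comp, Category.assoc, Category.assoc,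
    ← Category.assoc (K.map ((ihom _).map _)), expHom_naturality, Category.assoc,
    ← (ihom _).map_comp]
  rfl

end LogicalFunctors

section Transport

variable {E : Type u₁} [Category.{v₁} E] [ElementaryTopos E] {F : Type u₂} [Category.{v₂} F]
  [ElementaryTopos F] {G : Type u₃} [Category.{v₃} G] [ElementaryTopos G]

/-- The canonical isomorphism `L A ⊗ L B ⟶ L (A ⊗ B)`. -/
def kappa (L : E ⥤ F) [PreservesFiniteProducts L] (A B : E) :
    L.obj A ⊗ L.obj B ⟶ L.obj (A ⊗ B) := inv (prodComparison L A B)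

/-- The canonical isomorphism `(L A) ^ n ⟶ L (A ^ n)`. -/
def kappaPow (L : E ⥤ F) [PreservesFiniteProducts L] (n : ℕ) (A : E) :
    (∏ᶜ fun _ : Fin n => L.obj A) ⟶ L.obj (∏ᶜ fun _ : Fin n => A) :=
  inv (piComparison L fun _ : Fin n => A)

/-- The image of (the data of) an internal quantale under a logical functor. -/
abbrev QuantaleData.map (Q : QuantaleData E) (L : E ⥤ F) [IsLogical L] : QuantaleData F where
  carrier := L.obj Q.carrier
  mul := kappa L Q.carrier Q.carrier ≫ L.map Q.mul
  unit := inv (terminalComparison L) ≫ L.map Q.unit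
  le := kappa L Q.carrier Q.carrier ≫ L.map Q.le ≫ omegaHom L
  sup := inv (powHom L Q.carrier) ≫ L.map Q.sup

lemma kappa_id (A B : E) : kappa (𝟭 E) A B = 𝟙 (A ⊗ B) := by
  exact inv_eq_id _ prodComparison_id

lemma kappa_comp (L : E ⥤ F) (K : F ⥤ G) [PreservesFiniteProducts L] [PreservesFiniteProducts K]
    (A B : E) : kappa (L ⋙ K) A B = kappa K (L.obj A) (L.obj B) ≫ K.map (kappa L A B) :=
  inv_prodComparison_comp L K A B

lemma lift_map_kappa (L : E ⥤ F) [PreservesFiniteProducts L] {X A B : E} (a : X ⟶ A)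
    (b : X ⟶ B) : lift (L.map a) (L.map b) ≫ kappa L A B = L.map (lift a b) := by
  unfold kappa
  rw [IsIso.comp_inv_eq]
  ext <;> simp [← L.map_comp]

lemma piLift_map_kappaPow (L : E ⥤ F) [PreservesFiniteProducts L] {X A : E} {n : ℕ}
    (a : Fin n → (X ⟶ A)) :
    Pi.lift (fun i => L.map (a i)) ≫ kappaPow L n A = L.map (Pi.lift a) := by
  unfold kappaPow
  rw [IsIso.comp_inv_eq, map_lift_piComparison]

lemma kappaPow_id (n : ℕ) (A : E) : kappaPow (𝟭 E) n A = 𝟙 (∏ᶜ fun _ : Fin n => A) := by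
  have h := piLift_map_kappaPow (𝟭 E) (fun i => Pi.π (fun _ : Fin n => A) i)
  have e : Pi.lift (fun i => Pi.π (fun _ : Fin n => A) i) = 𝟙 _ := by ext i; simp
  exact (Category.id_comp _).symm.trans
    ((congrArg (· ≫ kappaPow (𝟭 E) n A) e.symm).trans (h.trans e))

lemma kappaPow_comp (L : E ⥤ F) (K : F ⥤ G) [PreservesFiniteProducts L]
    [PreservesFiniteProducts K] (n : ℕ) (A : E) :
    kappaPow (L ⋙ K) n A = kappaPow K n (L.obj A) ≫ K.map (kappaPow L n A) := by
  refine inv_eq_of_eq_map_comp K (piComparison L fun _ : Fin n => A)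
    (piComparison K fun _ : Fin n => L.obj A) (piComparison (L ⋙ K) fun _ : Fin n => A) ?_
  apply Pi.hom_ext
  intro i
  have h1 : K.map (L.map (Pi.π (fun _ : Fin n => A) i)) = _ :=
    (piComparison_comp_π (L ⋙ K) (fun _ : Fin n => A) i).symm
  have h2 : piComparison K (fun _ : Fin n => L.obj A) ≫ Pi.π (fun _ => (L ⋙ K).obj A) i =
      K.map (Pi.π (fun _ : Fin n => L.obj A) i) :=
    piComparison_comp_π K (fun _ : Fin n => L.obj A) i
  rw [← h1, Category.assoc, h2, ← K.map_comp, piComparison_comp_π]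

lemma QuantaleData.map_id (Q : QuantaleData E) : Q.map (𝟭 E) = Q := by
  have h : inv (terminalComparison (𝟭 E)) = 𝟙 (𝟙_ E) := Subsingleton.elim (α := _ ⟶ 𝟙_ E) _ _
  have h' : inv (powHom (𝟭 E) Q.carrier) = 𝟙 (Pow Q.carrier) := 
    inv_eq_id _ (powHom_id _)
  unfold QuantaleData.map
  rw [kappa_id, omegaHom_id, h, h']
  ext1 <;> simp

lemma QuantaleData.map_comp (Q : QuantaleData E) (L : E ⥤ F) (K : F ⥤ G) [IsLogical L]
    [IsLogical K] : Q.map (L ⋙ K) = (Q.map L).map K := by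
  have h : inv (terminalComparison (L ⋙ K)) =
      inv (terminalComparison K) ≫ K.map (inv (terminalComparison L)) := 
    inv_eq_of_eq_map_comp K (terminalComparison L) (terminalComparison K)
      (terminalComparison (L ⋙ K)) (Subsingleton.elim _ _)
  have h' : inv (powHom (L ⋙ K) Q.carrier) =
      inv (powHom K (L.obj Q.carrier)) ≫ K.map (inv (powHom L Q.carrier)) := 
    inv_eq_of_eq_map_comp K (powHom L Q.carrier) (powHom K (L.obj Q.carrier))
      (powHom (L ⋙ K) Q.carrier) (powHom_comp L K Q.carrier)
  unfold QuantaleData.map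
  rw [kappa_comp, omegaHom_comp, h, h']
  ext1 <;> simp

variable {S : Signature.{w}}

lemma lift_op_map (L : E ⥤ F) [PreservesFiniteProducts L] {A X : E} {n : ℕ}
    (op : (∏ᶜ fun _ : Fin n => A) ⟶ A) (a : Fin n → (X ⟶ A)) :
    Pi.lift (fun i => L.map (a i)) ≫ kappaPow L n A ≫ L.map op = L.map (Pi.lift a ≫ op) := by
  rw [← Category.assoc, piLift_map_kappaPow, L.map_comp]

lemma Term.map_eval (L : E ⥤ F) [PreservesFiniteProducts L] {A : E}
    (op : ∀ σ : S.Op, (∏ᶜ fun _ : Fin (S.arity σ) => A) ⟶ A)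
    {n : ℕ} {X : E} (ρ : Fin n → (X ⟶ A)) (t : Term S.arity n) :
    t.eval (fun σ => kappaPow L (S.arity σ) A ≫ L.map (op σ)) (fun i => L.map (ρ i)) =
      L.map (t.eval op ρ) := by
  induction t with
  | var i => rfl
  | app σ args ih => simp only [Term.eval, ih, lift_op_map]

lemma kappaPow_map_π (L : E ⥤ F) [PreservesFiniteProducts L] {A : E} {n : ℕ} (i : Fin n) :
    kappaPow L n A ≫ L.map (Pi.π (fun _ : Fin n => A) i) = Pi.π (fun _ : Fin n => L.obj A) i := by
  unfold kappaPow
  rw [IsIso.inv_comp_eq, piComparison_comp_π]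

/-- The image of an algebra under a functor preserving finite products. -/
abbrev Algebra.map (A : Algebra S E) (L : E ⥤ F) [PreservesFiniteProducts L] : Algebra S F where
  carrier := L.obj A.carrier
  op σ := kappaPow L (S.arity σ) A.carrier ≫ L.map (A.op σ)
  eqs n e he := by
    have key : ∀ t : Term S.arity n,
        t.eval (fun σ => kappaPow L (S.arity σ) A.carrier ≫ L.map (A.op σ))
          (fun i => Pi.π (fun _ : Fin n => L.obj A.carrier) i) =
        kappaPow L n A.carrier ≫ L.map (t.eval A.op fun i => Pi.π (fun _ : Fin n => A.carrier) i) := by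
      intro t
      rw [← Term.map_eval, Term.comp_eval]
      simp only [kappaPow_map_π]
    rw [key, key, A.eqs n e he]

/-- The image `L A ⊗ L B ⟶ L (A ⊗ B) ⟶ L Q` of a `Q`-relation. -/
def mapRel {Q : QuantaleData E} (L : E ⥤ F) [IsLogical L] {A B : E} (R : A ⊗ B ⟶ Q.carrier) :
    L.obj A ⊗ L.obj B ⟶ (Q.map L).carrier := kappa L A B ≫ L.map R

section

variable {Q : QuantaleData E} (L : E ⥤ F) [IsLogical L]

lemma map_ap {A B X : E} (R : A ⊗ B ⟶ Q.carrier) (a : X ⟶ A) (b : X ⟶ B) :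
    L.map (ap R a b) = ap (Q := Q.map L) (mapRel L R) (L.map a) (L.map b) := by
  unfold ap mapRel
  rw [← Category.assoc, lift_map_kappa, L.map_comp]

lemma map_m {X : E} (x y : X ⟶ Q.carrier) :
    L.map (Q.m x y) = (Q.map L).m (L.map x) (L.map y) := by
  unfold QuantaleData.m
  rw [L.map_comp, ← lift_map_kappa, Category.assoc]

lemma map_one (X : E) : L.map (Q.one X) = (Q.map L).one (L.obj X) := by
  unfold QuantaleData.one
  rw [L.map_comp, ← Category.assoc]
  congr 1
  rw [IsIso.eq_comp_inv]
  exact Subsingleton.elim _ _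

lemma map_prod {X : E} {n : ℕ} (x : Fin n → (X ⟶ Q.carrier)) :
    L.map (Q.prod x) = (Q.map L).prod (fun i => L.map (x i)) := by
  induction n with
  | zero => exact map_one L X
  | succ n ih => rw [QuantaleData.prod, map_m, ih]; rfl

lemma Le.map {X : E} {x y : X ⟶ Q.carrier} (h : Q.Le x y) :
    (Q.map L).Le (X := L.obj X) (L.map x) (L.map y) := by
  unfold QuantaleData.Le at h ⊢
  have : lift (L.map x) (L.map y) ≫ kappa L Q.carrier Q.carrier ≫ L.map Q.le ≫ omegaHom L =
      tt (L.obj X) := by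
    rw [← Category.assoc, lift_map_kappa, ← Category.assoc, ← L.map_comp, h, map_tt]
  exact this

lemma IsAlgebraic.map {A B : Algebra S E} {R : A.carrier ⊗ B.carrier ⟶ Q.carrier}
    (h : IsAlgebraic A B R) : IsAlgebraic (Q := Q.map L) (A.map L) (B.map L) (mapRel L R) := by
  intro σ X a b
  let n := S.arity σ
  let PA := ∏ᶜ fun _ : Fin n => A.carrier
  let PB := ∏ᶜ fun _ : Fin n => B.carrier
  let a' : Fin n → (PA ⊗ PB ⟶ A.carrier) := fun i => fst PA PB ≫ Pi.π (fun _ : Fin n => A.carrier) i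
  let b' : Fin n → (PA ⊗ PB ⟶ B.carrier) := fun i => snd PA PB ≫ Pi.π (fun _ : Fin n => B.carrier) i
  have h' := Le.map L (h σ _ a' b')
  rw [map_prod] at h'
  simp only [map_ap] at h'
  let f : X ⟶ L.obj (PA ⊗ PB) :=
    lift (Pi.lift a ≫ kappaPow L n A.carrier) (Pi.lift b ≫ kappaPow L n B.carrier) ≫ kappa L PA PB
  have f1 : f ≫ L.map (fst PA PB) = Pi.lift a ≫ kappaPow L n A.carrier := by
    simp only [f, kappa, Category.assoc, CartesianMonoidalCategory.inv_prodComparison_map_fst]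
    exact lift_fst _ _
  have f2 : f ≫ L.map (snd PA PB) = Pi.lift b ≫ kappaPow L n B.carrier := by
    simp only [f, kappa, Category.assoc, CartesianMonoidalCategory.inv_prodComparison_map_snd]
    exact lift_snd _ _
  have ha : ∀ i, f ≫ L.map (a' i) = a i := by
    intro i
    rw [L.map_comp, ← Category.assoc, f1, Category.assoc, kappaPow_map_π, Pi.lift_π]
  have hb : ∀ i, f ≫ L.map (b' i) = b i := by
    intro i
    rw [L.map_comp, ← Category.assoc, f2, Category.assoc, kappaPow_map_π, Pi.lift_π]
  have h'' := h'.comp f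
  rw [comp_prod, comp_ap] at h''
  simp only [comp_ap, ha, hb] at h''
  refine cast ?_ h''
  congr 2
  · have e : Pi.lift a' = fst PA PB := by ext i; simp [a']
    rw [L.map_comp, e, ← Category.assoc, f1, Category.assoc]
  · have e : Pi.lift b' = snd PA PB := by ext i; simp [b']
    rw [L.map_comp, e, ← Category.assoc, f2, Category.assoc]

end

end Transport

section Induced

/-- A (strong) symmetric monoidal functor. -/
structure SymMonFunctor (C : Type u₁) [Category.{v₁} C] [MonoidalCategory C] [SymmetricCategory C]
    (D : Type u₂) [Category.{v₂} D] [MonoidalCategory D] [SymmetricCategory D] extends C ⥤ D where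
  /-- the monoidal structure, compatible with the symmetries -/
  braided : toFunctor.Braided

namespace SymMonFunctor

/-- The identity symmetric monoidal functor. -/
def id (C : Type u₁) [Category.{v₁} C] [MonoidalCategory C] [SymmetricCategory C] :
    SymMonFunctor C C where
  toFunctor := 𝟭 C
  braided := inferInstance

/-- The composite of two symmetric monoidal functors. -/
def comp {C : Type u₁} [Category.{v₁} C] [MonoidalCategory C] [SymmetricCategory C]
    {D : Type u₂} [Category.{v₂} D] [MonoidalCategory D] [SymmetricCategory D]
    {D' : Type u₃} [Category.{v₃} D'] [MonoidalCategory D'] [SymmetricCategory D']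
    (G : SymMonFunctor C D) (H : SymMonFunctor D D') : SymMonFunctor C D' where
  toFunctor := G.toFunctor ⋙ H.toFunctor
  braided :=
    let _ := G.braided
    let _ := H.braided
    inferInstance

end SymMonFunctor

/-- The assignment `A ↦ L A`, `R ↦ (L A ⊗ L B ≅ L (A ⊗ B) ⟶ L Q)` on algebras and algebraic
relations, where `L Q = Q'`. -/
def relMap (S : Signature.{w}) {E : Type u₁} [Category.{v₁} E] [ElementaryTopos E] {F : Type u₂}
    [Category.{v₂} F] [ElementaryTopos F] (L : E ⥤ F) [IsLogical L]
    (Q : QuantaleData E) [Q.IsCommQuantale] (Q' : QuantaleData F) [Q'.IsCommQuantale]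
    (h : Q.map L = Q') : Rel S Q ⥤q Rel S Q' where
  obj A := ⟨A.alg.map L⟩
  map {A B} R := ⟨mapRel L (Rel.rel R) ≫ eqToHom (congrArg QuantaleData.carrier h), by
    subst h
    rw [eqToHom_refl, Category.comp_id]
    exact IsAlgebraic.map L (Rel.Hom.algebraic R)⟩

end Induced

end

end ToposRel

open ToposRel

/-! A logical functor preserves everything by which the internal language is interpreted, so what
holds internally in `E` should hold in `F`. The point needing care is that validity in `F`
quantifies over generalized elements at all stages of `F`, while `L` only provides the stages `L X`.
Because `L` preserves finite products, any tuple of elements of `L A`, `L B`, … at a stage `X` is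
the restriction, along a single morphism from `X` to the image of the product, of the images of the
projections (`exists_comp_map₂`). So it is enough to transfer entailments between predicates along
arbitrary morphisms `x : T ⟶ L.obj X`.

Entailments are transferred by writing them as equations. That φ entails ψ means φ ∧ ψ = φ
(`comp_mapPred_mono`); a hypothesis ∀ a, φ → ψ means {a | φ ∧ ψ} = {a | φ} in a power object, and
power objects are preserved (`comp_mapPred_forall`). Existential statements follow, since the image
of `h` is the intersection of all subsets containing every `h i` (`mapPred_inImage`). This yields
the quantale axioms for the image of `Q`, with all axioms on joins condensed into the least upper
bound property of `a ⊗ ⋁ S` (`IsCommQuantale.of_m_sup_le_iff`). It also shows that `L` preserves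
indexed joins (`map_join`).

Identities, graphs and composites of relations are such joins, hence are preserved, and tensors of
relations only involve projections and the multiplication. The monoidal structure on the induced
functor consists of the graphs of the canonical isomorphisms 1 ≅ L 1 and L A ⊗ L B ≅ L (A ⊗ B).
Taking graphs respects composition and tensor, so coherence reduces to the known coherence of
product-preserving functors. Functoriality in `L` holds because the comparison maps of a composite
are composites of comparison maps; the algebras on the two sides have the same carriers by
definition, so transport between them is an identity relation. -/

namespace ToposRel

noncomputable section

open HasSubobjectClassifier

/-! ### Conjunction, equality, extensionality and images in the internal logic of a topos. -/

section Predicates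

variable {E : Type u} [Category.{v} E] [ElementaryTopos E]

/-- The conjunction of truth values. -/
def conj (E : Type u) [Category.{v} E] [ElementaryTopos E] : Ω E ⊗ Ω E ⟶ Ω E :=
  χ (equalizer.ι (𝟙 (Ω E ⊗ Ω E)) (lift (tt _) (tt _)))

lemma lift_conj_eq_tt_iff {X : E} (p q : X ⟶ Ω E) :
    lift p q ≫ conj E = tt X ↔ p = tt X ∧ q = tt X := by
  rw [conj, comp_chi_eq_tt_iff]
  constructor
  · rintro ⟨l, hl⟩
    have h := l ≫= equalizer.condition (𝟙 (Ω E ⊗ Ω E)) (lift (tt _) (tt _))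
    rw [Category.comp_id, hl, ← Category.assoc, hl, comp_lift, comp_tt] at h
    exact ⟨by simpa using h =≫ fst _ _, by simpa using h =≫ snd _ _⟩
  · rintro ⟨rfl, rfl⟩
    exact ⟨equalizer.lift (lift (tt X) (tt X)) (by simp [comp_lift]), by simp⟩

/-- The equality predicate. -/
def eqPred (A : E) : A ⊗ A ⟶ Ω E :=
  have : Mono (lift (𝟙 A) (𝟙 A)) := mono_lift_of_mono_left _ _
  χ (lift (𝟙 A) (𝟙 A))

lemma lift_eqPred_eq_tt_iff {A X : E} (a b : X ⟶ A) : lift a b ≫ eqPred A = tt X ↔ a = b := by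
  have : Mono (lift (𝟙 A) (𝟙 A)) := mono_lift_of_mono_left _ _
  rw [eqPred, comp_chi_eq_tt_iff]
  constructor
  · rintro ⟨l, hl⟩
    have h1 := hl =≫ fst _ _
    have h2 := hl =≫ snd _ _
    simp at h1 h2
    rw [← h1, h2]
  · rintro rfl
    exact ⟨a, by simp [comp_lift]⟩

/-- Extensionality for subsets: transposing gives predicates on `A ⊗ X`, which are determined by the
generalized elements at which they are true, and such an element is a stage over `X` with an element
of `A`. -/
lemma pow_ext {A X : E} {S S' : X ⟶ Pow A}
    (h : ∀ (T : E) (f : T ⟶ X) (a : T ⟶ A), mem a (f ≫ S) = tt T ↔ mem a (f ≫ S') = tt T) :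
    S = S' := by
  apply MonoidalClosed.uncurry_injective
  refine omega_ext fun T p => ?_
  have e : ∀ S : X ⟶ Pow A,
      p ≫ MonoidalClosed.uncurry S = mem (p ≫ fst _ _) ((p ≫ snd _ _) ≫ S) := by
    intro S
    have : p ≫ A ◁ S = lift (p ≫ fst _ _) ((p ≫ snd _ _) ≫ S) := by ext <;> simp
    rw [MonoidalClosed.uncurry_eq, ← Category.assoc, this]
    rfl
  rw [e, e]
  exact h T _ _

/-- Needed in `map_join` to compare the image computed inside `L (Q ⊗ X)` with the one inside `L Q ⊗
L X`. -/
lemma comp_inImage_iso {I Z Z' : E} (h : I ⟶ Z) (e : Z ≅ Z') :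
    e.hom ≫ inImage (h ≫ e.hom) = inImage h := by
  refine omega_ext fun T p => ⟨fun hp => ?_, fun hp => ?_⟩
  · rw [← Category.assoc] at hp
    refine inImage_elim _ _ hp _ fun T' t i hi => ?_
    have : t ≫ p = i ≫ h := by
      rw [← cancel_mono e.hom]
      simpa using hi
    rw [← Category.assoc, this, self_comp_inImage]
  · refine inImage_elim _ _ hp _ fun T' t i hi => ?_
    rw [← Category.assoc, hi]
    simpa using self_comp_inImage (h ≫ e.hom) i

end Predicates

/-! ### Transfer of truth, entailment, comprehension and images along a logical functor. -/

section LogicalFunctor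

variable {E : Type u₁} [Category.{v₁} E] [ElementaryTopos E] {F : Type u₂} [Category.{v₂} F]
  [ElementaryTopos F] (L : E ⥤ F) [IsLogical L]

lemma comp_map_lift {X A B : E} {T : F} (x : T ⟶ L.obj X) (a : X ⟶ A) (b : X ⟶ B) :
    x ≫ L.map (lift a b) = lift (x ≫ L.map a) (x ≫ L.map b) ≫ kappa L A B := by
  rw [← lift_map_kappa, ← Category.assoc, comp_lift]

lemma kappa_map_fst (A B : E) : kappa L A B ≫ L.map (fst A B) = fst _ _ :=
  CartesianMonoidalCategory.inv_prodComparison_map_fst L A B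

lemma kappa_map_snd (A B : E) : kappa L A B ≫ L.map (snd A B) = snd _ _ :=
  CartesianMonoidalCategory.inv_prodComparison_map_snd L A B

/-- The image of a predicate under a logical functor. -/
def mapPred {X : E} (φ : X ⟶ Ω E) : L.obj X ⟶ Ω F := L.map φ ≫ omegaHom L

lemma map_comp_mapPred {X Y : E} (f : X ⟶ Y) (φ : Y ⟶ Ω E) :
    L.map f ≫ mapPred L φ = mapPred L (f ≫ φ) := by
  rw [mapPred, mapPred, L.map_comp, Category.assoc]

lemma mapPred_tt (X : E) : mapPred L (tt X) = tt (L.obj X) := map_tt L X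

/-- Truth can be tested before the isomorphism `omegaHom L`. There it is an equation between
composites of `x` with image morphisms, to which functoriality of `L` applies. -/
lemma comp_mapPred_eq_tt_iff {X : E} {T : F} (x : T ⟶ L.obj X) (φ : X ⟶ Ω E) :
    x ≫ mapPred L φ = tt T ↔ x ≫ L.map φ = x ≫ L.map (tt X) := by
  rw [← cancel_mono (omegaHom L), Category.assoc, Category.assoc, map_tt, comp_tt]
  rfl

/-- The entailment is the equation φ ∧ ψ = φ, which `L` preserves. Where φ agrees with true, ψ =
true ∧ ψ agrees with φ ∧ ψ = φ, hence with true. The element `x` lives at an arbitrary stage of `F`.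
-/
lemma comp_mapPred_mono {X : E} {φ ψ : X ⟶ Ω E}
    (h : ∀ (T : E) (p : T ⟶ X), p ≫ φ = tt T → p ≫ ψ = tt T)
    {T : F} {x : T ⟶ L.obj X} (hx : x ≫ mapPred L φ = tt T) : x ≫ mapPred L ψ = tt T := by
  have e1 : lift φ ψ ≫ conj E = φ := omega_ext fun T p => by
    rw [← Category.assoc, comp_lift, lift_conj_eq_tt_iff]
    exact ⟨fun h => h.1, fun hp => ⟨hp, h T p hp⟩⟩
  have e2 : lift (tt X) ψ ≫ conj E = ψ := omega_ext fun T p => by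
    rw [← Category.assoc, comp_lift, lift_conj_eq_tt_iff, comp_tt]
    exact ⟨fun h => h.2, fun hp => ⟨rfl, hp⟩⟩
  rw [comp_mapPred_eq_tt_iff] at hx ⊢
  conv_lhs => rw [← e2, L.map_comp, ← Category.assoc, comp_map_lift, ← hx, ← comp_map_lift,
    Category.assoc, ← L.map_comp, e1]
  exact hx

lemma comp_mapPred_conj {X : E} {φ ψ : X ⟶ Ω E} {T : F} {x : T ⟶ L.obj X}
    (hφ : x ≫ mapPred L φ = tt T) (hψ : x ≫ mapPred L ψ = tt T) :
    x ≫ mapPred L (lift φ ψ ≫ conj E) = tt T := by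
  rw [comp_mapPred_eq_tt_iff] at hφ hψ ⊢
  rw [L.map_comp, ← Category.assoc, comp_map_lift, hφ, hψ, ← comp_map_lift, Category.assoc,
    ← L.map_comp, (lift_conj_eq_tt_iff _ _).2 ⟨rfl, rfl⟩]

lemma comp_mapPred_mono₂ {X : E} {φ₁ φ₂ ψ : X ⟶ Ω E}
    (h : ∀ (T : E) (p : T ⟶ X), p ≫ φ₁ = tt T → p ≫ φ₂ = tt T → p ≫ ψ = tt T)
    {T : F} {x : T ⟶ L.obj X} (h₁ : x ≫ mapPred L φ₁ = tt T) (h₂ : x ≫ mapPred L φ₂ = tt T) :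
    x ≫ mapPred L ψ = tt T := by
  refine comp_mapPred_mono L (φ := lift φ₁ φ₂ ≫ conj E) (fun T p hp => ?_)
    (comp_mapPred_conj L h₁ h₂)
  rw [← Category.assoc, comp_lift, lift_conj_eq_tt_iff] at hp
  exact h T p hp.1 hp.2

/-- After composing with `x`, the pair (a, b) may be replaced by (a, a), whose equality is already
true in `E`. -/
lemma comp_mapPred_eqPred {X A : E} {a b : X ⟶ A} {T : F} {x : T ⟶ L.obj X}
    (h : x ≫ L.map a = x ≫ L.map b) : x ≫ mapPred L (lift a b ≫ eqPred A) = tt T := by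
  rw [comp_mapPred_eq_tt_iff, L.map_comp, ← Category.assoc, comp_map_lift, ← h, ← comp_map_lift,
    Category.assoc, ← L.map_comp, (lift_eqPred_eq_tt_iff _ _).2 rfl]

/-- `powHom` is the transpose of the image of evaluation, followed by `omegaHom`; thus membership in
`F` is the image of membership in `E`. -/
lemma lift_powHom_ev (A : E) {T : F} (a : T ⟶ L.obj A) (S : T ⟶ L.obj (Pow A)) :
    mem a (S ≫ powHom L A) = lift a S ≫ kappa L A (Pow A) ≫ mapPred L ((ihom.ev A).app (Ω E)) := by
  have h := uncurry_expHom L A (Ω E)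
  rw [MonoidalClosed.uncurry_eq] at h
  have e : lift a (S ≫ powHom L A) = lift a S ≫ L.obj A ◁ expHom L A (Ω E) ≫
      L.obj A ◁ (ihom (L.obj A)).map (omegaHom L) := by
    unfold powHom
    ext <;> simp
  unfold mem mapPred
  rw [e, Category.assoc, Category.assoc, ihom.ev_naturality, ← Category.assoc (L.obj A ◁ _), h]
  simp [kappa]

lemma mapPred_mem {A X : E} (a : X ⟶ A) (S : X ⟶ Pow A) :
    mapPred L (mem a S) = mem (L.map a) (L.map S ≫ powHom L A) := by
  rw [lift_powHom_ev, ← Category.assoc, lift_map_kappa, map_comp_mapPred]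
  rfl

/-- Both subsets have the same elements: by `lift_powHom_ev`, membership in the left one is the
image of evaluation after `comprehension P`, and this composite is `P`. -/
lemma map_comprehension {A X : E} (P : A ⊗ X ⟶ Ω E) :
    L.map (comprehension P) ≫ powHom L A = comprehension (kappa L A X ≫ mapPred L P) := by
  refine pow_ext fun T f a => ?_
  have e1 : lift a f ≫ kappa L A X ≫ L.map (A ◁ comprehension P) =
      lift a (f ≫ L.map (comprehension P)) ≫ kappa L A (Pow A) := by
    have e : A ◁ comprehension P = lift (fst _ _) (snd _ _ ≫ comprehension P) := by ext <;> simp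
    rw [e, ← Category.assoc, comp_map_lift, L.map_comp]
    simp only [Category.assoc]
    rw [kappa_map_fst, ← Category.assoc (kappa L A X), kappa_map_snd]
    simp
  have e2 : (A ◁ comprehension P) ≫ (ihom.ev A).app (Ω E) = P := by
    rw [← MonoidalClosed.uncurry_eq, comprehension, MonoidalClosed.uncurry_curry]
  rw [mem_comprehension, ← Category.assoc, lift_powHom_ev, ← Category.assoc, ← e1]
  simp only [Category.assoc]
  rw [map_comp_mapPred, e2]

/-- Implications with a universally quantified hypothesis are preserved by logical functors. -/
lemma comp_mapPred_forall {A X : E} {φ ψ : A ⊗ X ⟶ Ω E} {ζ θ : X ⟶ Ω E}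
    (h : ∀ (T : E) (x : T ⟶ X), x ≫ ζ = tt T → (∀ (V : E) (f : V ⟶ T) (a : V ⟶ A),
      lift a (f ≫ x) ≫ φ = tt V → lift a (f ≫ x) ≫ ψ = tt V) → x ≫ θ = tt T)
    {T : F} {x : T ⟶ L.obj X} (hζ : x ≫ mapPred L ζ = tt T)
    (hx : ∀ (V : F) (f : V ⟶ T) (a : V ⟶ L.obj A),
      lift a (f ≫ x) ≫ kappa L A X ≫ mapPred L φ = tt V →
        lift a (f ≫ x) ≫ kappa L A X ≫ mapPred L ψ = tt V) :
    x ≫ mapPred L θ = tt T := by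
  -- The quantified hypothesis becomes one predicate on `X`, the equality {a | φ ∧ ψ} = {a | φ} of
  -- elements of `Pow A`, which reduces the claim to an ordinary entailment.
  refine comp_mapPred_mono₂ L (φ₁ := ζ) (φ₂ := lift (comprehension (lift φ ψ ≫ conj E))
    (comprehension φ) ≫ eqPred (Pow A)) (fun T p h₁ h₂ => h T p h₁ fun V f a ha => ?_) hζ
    (comp_mapPred_eqPred L ?_)
  · rw [← Category.assoc, comp_lift, lift_eqPred_eq_tt_iff] at h₂
    have e := mem_comprehension φ a (f ≫ p)
    rw [Category.assoc, ← h₂, ← Category.assoc, mem_comprehension, ha, ← Category.assoc, comp_lift,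
      lift_conj_eq_tt_iff] at e
    exact e.2
  -- In `F` the two subsets may be compared after the isomorphism `powHom`, where they are
  -- comprehensions of the image predicates and extensionality reduces to `hx`.
  · rw [← cancel_mono (powHom L A), Category.assoc, Category.assoc, map_comprehension,
      map_comprehension]
    refine pow_ext fun V f a => ?_
    rw [← Category.assoc, ← Category.assoc, mem_comprehension, mem_comprehension]
    constructor
    · intro ha
      rw [← Category.assoc] at ha ⊢
      refine comp_mapPred_mono L (fun T p hp => ?_) ha
      rw [← Category.assoc, comp_lift, lift_conj_eq_tt_iff] at hp
      exact hp.1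
    · intro ha
      have := hx V f a ha
      rw [← Category.assoc] at ha this ⊢
      exact comp_mapPred_conj L ha this

/-- Logical functors preserve images. -/
lemma mapPred_inImage {I Z : E} (h : I ⟶ Z) : mapPred L (inImage h) = inImage (L.map h) := by
  refine omega_ext fun T p => ⟨fun hp => ?_, fun hp => ?_⟩
  -- The test subset is the image of `L h` itself, constant over `T`; being a subset in `F`, it is
  -- moved into `L (Pow Z)` by the inverse of `powHom`.
  · let S : T ⟶ Pow (L.obj Z) := comprehension (fst _ _ ≫ inImage (L.map h))
    let x : T ⟶ L.obj (Pow Z ⊗ Z) := lift (S ≫ inv (powHom L Z)) p ≫ kappa L _ _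
    have x1 : x ≫ L.map (fst _ _) = S ≫ inv (powHom L Z) := by
      simp only [x, Category.assoc, kappa_map_fst, lift_fst]
    have x2 : x ≫ L.map (snd _ _) = p := by
      simp only [x, Category.assoc, kappa_map_snd, lift_snd]
    -- The rule transferred from `E` is that a point of the image of `h` lies in every `S`
    -- containing all `h i`. The index `i` is unrestricted, so the guard φ is true.
    have key := comp_mapPred_forall L (A := I) (X := Pow Z ⊗ Z) (φ := tt _)
      (ψ := mem (fst _ _ ≫ h) (snd _ _ ≫ fst _ _)) (ζ := snd _ _ ≫ inImage h)
      (θ := mem (snd _ _) (fst _ _)) (fun T x h₁ h₂ => by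
        rw [← Category.assoc] at h₁
        refine inImage_elim _ _ h₁ _ fun T' t i hi => ?_
        have := h₂ T' t i (by simp)
        rw [comp_mem] at this ⊢
        rw [comp_mem, hi]
        simpa using this) (T := T) (x := x) (by
          rw [← map_comp_mapPred, ← Category.assoc, x2, hp]) (fun V f a _ => by
          rw [mapPred_mem, comp_mem, comp_mem, L.map_comp, L.map_comp]
          simp only [← Category.assoc (kappa _ _ _), Category.assoc, kappa_map_fst, kappa_map_snd]
          have e1 : lift a (f ≫ x) ≫ fst _ _ ≫ L.map h = a ≫ L.map h := by
            rw [← Category.assoc, lift_fst]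
          have e2 : lift a (f ≫ x) ≫ snd _ _ ≫ L.map (fst _ _) ≫ powHom L Z = f ≫ S := by
            rw [← Category.assoc, lift_snd, Category.assoc, ← Category.assoc x, x1]
            simp
          rw [e1, e2, mem_comprehension, ← Category.assoc, lift_fst, self_comp_inImage])
    rw [mapPred_mem, comp_mem, x2, ← Category.assoc, x1, Category.assoc, IsIso.inv_hom_id,
      Category.comp_id] at key
    have hS := mem_comprehension (fst _ _ ≫ inImage (L.map h)) p (𝟙 T)
    rw [Category.id_comp, ← Category.assoc, lift_fst] at hS
    exact hS.symm.trans key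
  -- Conversely, the point may be taken of the form `L h` applied to some `i`, and `h ≫ inImage h`
  -- is true in `E`.
  · refine inImage_elim _ _ hp _ fun T' t i hi => ?_
    rw [← Category.assoc, hi, Category.assoc, map_comp_mapPred]
    have : h ≫ inImage h = tt _ := by simpa using self_comp_inImage h (𝟙 _)
    rw [this, mapPred_tt, comp_tt]

end LogicalFunctor

end

end ToposRel

/-! ### Logical functors preserve internal commutative quantales. -/

namespace ToposRel

noncomputable section

open HasSubobjectClassifier

namespace QuantaleData

/-- An internal commutative quantale is determined by a partial order and a commutative monoid
structure, such that `a ⊗ ⋁ S` is the least upper bound of all `a ⊗ s` with `s ∈ S`. -/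
lemma IsCommQuantale.of_m_sup_le_iff {E : Type u} [Category.{v} E] [ElementaryTopos E]
    {Q : QuantaleData E} (le_refl : ∀ {X : E} (x : X ⟶ Q.carrier), Q.Le x x)
    (le_trans : ∀ {X : E} (x y z : X ⟶ Q.carrier), Q.Le x y → Q.Le y z → Q.Le x z)
    (le_antisymm : ∀ {X : E} (x y : X ⟶ Q.carrier), Q.Le x y → Q.Le y x → x = y)
    (mul_assoc : ∀ {X : E} (x y z : X ⟶ Q.carrier), Q.m (Q.m x y) z = Q.m x (Q.m y z))
    (one_mul : ∀ {X : E} (x : X ⟶ Q.carrier), Q.m (Q.one X) x = x)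
    (mul_comm : ∀ {X : E} (x y : X ⟶ Q.carrier), Q.m x y = Q.m y x)
    (m_sup_le_iff : ∀ {X : E} (a : X ⟶ Q.carrier) (S : X ⟶ Pow Q.carrier) (z : X ⟶ Q.carrier),
      Q.Le (Q.m a (S ≫ Q.sup)) z ↔ ∀ (Y : E) (f : Y ⟶ X) (s : Y ⟶ Q.carrier),
        mem s (f ≫ S) = tt Y → Q.Le (Q.m (f ≫ a) s) (f ≫ z)) :
    Q.IsCommQuantale := by
  have sup_le_iff : ∀ {X : E} (S : X ⟶ Pow Q.carrier) (z : X ⟶ Q.carrier),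
      Q.Le (S ≫ Q.sup) z ↔ ∀ (Y : E) (f : Y ⟶ X) (s : Y ⟶ Q.carrier),
        mem s (f ≫ S) = tt Y → Q.Le s (f ≫ z) := by
    intro X S z
    -- Multiplying by the unit turns the property of `a ⊗ ⋁ S` into that of `⋁ S`.
    have := m_sup_le_iff (Q.one X) S z
    simpa only [comp_one, one_mul] using this
  have mul_sup : ∀ {X : E} (a : X ⟶ Q.carrier) (S : X ⟶ Pow Q.carrier),
      Q.m a (S ≫ Q.sup) = Q.join (Q.m (idx S ≫ a) (elt S)) (idx S) := by
    intro X a S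
    -- Two elements with the same upper bounds coincide by antisymmetry. For the join, an element of
    -- the indexing subset may be assumed to be a product with some `s ∈ S`, because `≤` is a truth
    -- value.
    have key : ∀ z, Q.Le (Q.m a (S ≫ Q.sup)) z ↔
        Q.Le (Q.join (Q.m (idx S ≫ a) (elt S)) (idx S)) z := by
      intro z
      rw [m_sup_le_iff, join, sup_le_iff]
      constructor
      · intro h Y f s hs
        rw [mem_comprehension] at hs
        refine inImage_elim _ _ hs _ fun T t i hi => ?_
        have h1 := hi =≫ fst _ _
        have h2 := hi =≫ snd _ _
        simp at h1 h2
        have := h T (t ≫ f) (i ≫ elt S) (by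
          rw [h2, Category.assoc, ← comp_mem, mem_elt, comp_tt])
        have h3 : i ≫ idx S ≫ a = (t ≫ f) ≫ a := by rw [h2, Category.assoc]
        rw [← Category.assoc, comp_lift, h1, comp_m, h3, ← Category.assoc t f z]
        exact this
      · intro h Y f s hs
        obtain ⟨e, rfl, rfl⟩ := exists_elements hs
        refine h Y _ _ ?_
        have := self_comp_inImage (lift (Q.m (idx S ≫ a) (elt S)) (idx S)) e
        rwa [comp_lift, comp_m, ← Category.assoc, ← mem_comprehension] at this
    exact le_antisymm _ _ ((key _).2 (le_refl _)) ((key _).1 (le_refl _))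
  exact
    { le_refl := le_refl
      le_trans := le_trans
      le_antisymm := le_antisymm
      sup_le_iff := sup_le_iff
      mul_assoc := mul_assoc
      one_mul := one_mul
      mul_one := fun x => by rw [mul_comm, one_mul]
      mul_sup := mul_sup
      sup_mul := fun S a => by rw [mul_comm, mul_sup, mul_comm]
      mul_comm := mul_comm }

end QuantaleData

variable {E : Type u₁} [Category.{v₁} E] [ElementaryTopos E] {F : Type u₂} [Category.{v₂} F]
  [ElementaryTopos F] (L : E ⥤ F) [IsLogical L]

/-- Reduces arbitrary elements in `F` to images of projections in `E`, restricted along a common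
`p`. -/
lemma exists_comp_map₂ {A B : E} {X : F} (a : X ⟶ L.obj A) (b : X ⟶ L.obj B) :
    ∃ p : X ⟶ L.obj (A ⊗ B), a = p ≫ L.map (fst _ _) ∧ b = p ≫ L.map (snd _ _) :=
  ⟨lift a b ≫ kappa L A B, by rw [Category.assoc, kappa_map_fst, lift_fst],
    by rw [Category.assoc, kappa_map_snd, lift_snd]⟩

lemma exists_comp_map₃ {A B C : E} {X : F} (a : X ⟶ L.obj A) (b : X ⟶ L.obj B)
    (c : X ⟶ L.obj C) :
    ∃ p : X ⟶ L.obj (A ⊗ (B ⊗ C)), a = p ≫ L.map (fst _ _) ∧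
      b = p ≫ L.map (snd _ _ ≫ fst _ _) ∧ c = p ≫ L.map (snd _ _ ≫ snd _ _) := by
  obtain ⟨q, rfl, rfl⟩ := exists_comp_map₂ L b c
  obtain ⟨p, rfl, rfl⟩ := exists_comp_map₂ L a q
  exact ⟨p, rfl, by simp, by simp⟩

namespace QuantaleData

variable (Q : QuantaleData E)

lemma map_m_comp {X : E} {T : F} (p : T ⟶ L.obj X) (x y : X ⟶ Q.carrier) :
    (Q.map L).m (p ≫ L.map x) (p ≫ L.map y) = p ≫ L.map (Q.m x y) := by
  rw [map_m, comp_m]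

lemma map_sup_comp {X : E} {T : F} (p : T ⟶ L.obj X) (S : X ⟶ Pow Q.carrier) :
    ((p ≫ L.map S) ≫ powHom L Q.carrier) ≫ (Q.map L).sup = p ≫ L.map (S ≫ Q.sup) := by
  simp

lemma mem_powHom_comp {A X : E} {T : F} (p : T ⟶ L.obj X) (a : X ⟶ A) (S : X ⟶ Pow A) :
    mem (p ≫ L.map a) ((p ≫ L.map S) ≫ powHom L A) = p ≫ mapPred L (mem a S) := by
  rw [mapPred_mem, comp_mem, Category.assoc]

/-- Puts the order of `Q.map L` into the form handled by the transfer lemmas: truth of an image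
predicate. -/
lemma map_le_comp_iff {X : E} {T : F} (p : T ⟶ L.obj X) (x y : X ⟶ Q.carrier) :
    (Q.map L).Le (p ≫ L.map x) (p ≫ L.map y) ↔ p ≫ mapPred L (lift x y ≫ Q.le) = tt T := by
  have : lift (p ≫ L.map x) (p ≫ L.map y) ≫ (Q.map L).le = p ≫ mapPred L (lift x y ≫ Q.le) := by
    rw [← Category.assoc, ← comp_map_lift, mapPred, L.map_comp]
    simp only [Category.assoc]
  rw [Le, this]

variable {Q} in
lemma le_iff {X : E} (T : E) (p : T ⟶ X) (x y : X ⟶ Q.carrier) :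
    p ≫ lift x y ≫ Q.le = tt T ↔ Q.Le (p ≫ x) (p ≫ y) := by
  rw [← Category.assoc, comp_lift]; rfl

/-- A join is built from an image, a comprehension and `sup`, all of which are preserved; the
`powHom` from the comprehension cancels its inverse in `(Q.map L).sup`. -/
lemma map_join {I X : E} (q : I ⟶ Q.carrier) (f : I ⟶ X) :
    L.map (Q.join q f) = (Q.map L).join (L.map q) (L.map f) := by
  have h : kappa L Q.carrier X ≫ inImage (L.map (lift q f)) =
      inImage (lift (L.map q) (L.map f)) := by
    rw [← lift_map_kappa]
    exact comp_inImage_iso (lift (L.map q) (L.map f)) (asIso (prodComparison L Q.carrier X)).symm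
  have h' := map_comprehension L (inImage (lift q f))
  rw [mapPred_inImage, h] at h'
  rw [join, join, ← h', L.map_comp]
  simp

variable [Q.IsCommQuantale]

/-- From left to right this is an entailment with two hypotheses. From right to left the hypothesis
quantifies over `s`, so `comp_mapPred_forall` is required. -/
lemma map_m_sup_le_iff {X : F} (a : X ⟶ L.obj Q.carrier) (S : X ⟶ Pow (L.obj Q.carrier))
    (z : X ⟶ L.obj Q.carrier) :
    (Q.map L).Le ((Q.map L).m a (S ≫ (Q.map L).sup)) z ↔
      ∀ (Y : F) (f : Y ⟶ X) (s : Y ⟶ L.obj Q.carrier),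
        mem s (f ≫ S) = tt Y → (Q.map L).Le ((Q.map L).m (f ≫ a) s) (f ≫ z) := by
  obtain ⟨S, rfl⟩ : ∃ S' : X ⟶ L.obj (Pow Q.carrier), S = S' ≫ powHom L Q.carrier :=
    ⟨S ≫ inv (powHom L Q.carrier), by simp⟩
  obtain ⟨p, rfl, rfl, rfl⟩ := exists_comp_map₃ L a S z
  rw [map_sup_comp, map_m_comp, map_le_comp_iff]
  -- The factors of this context are, in order, `s`, `a`, `S` and `z`.
  have hm : ∀ (Y : F) (q : Y ⟶ L.obj (Q.carrier ⊗ (Q.carrier ⊗ (Pow Q.carrier ⊗ Q.carrier)))),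
      mem (q ≫ L.map (fst _ _)) ((q ≫ L.map (snd _ _)) ≫ L.map (snd _ _ ≫ fst _ _) ≫
        powHom L Q.carrier) = q ≫ mapPred L (mem (fst _ _) (snd _ _ ≫ snd _ _ ≫ fst _ _)) := by
    intro Y q
    rw [← mem_powHom_comp]
    simp only [L.map_comp, Category.assoc]
  have hl : ∀ (Y : F) (q : Y ⟶ L.obj (Q.carrier ⊗ (Q.carrier ⊗ (Pow Q.carrier ⊗ Q.carrier)))),
      (Q.map L).Le ((Q.map L).m ((q ≫ L.map (snd _ _)) ≫ L.map (fst _ _)) (q ≫ L.map (fst _ _)))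
        ((q ≫ L.map (snd _ _)) ≫ L.map (snd _ _ ≫ snd _ _)) ↔
      q ≫ mapPred L (lift (Q.m (snd _ _ ≫ fst _ _) (fst _ _)) (snd _ _ ≫ snd _ _ ≫ snd _ _) ≫
        Q.le) = tt Y := by
    intro Y q
    rw [← map_le_comp_iff, ← map_m_comp]
    simp only [L.map_comp, Category.assoc]
  constructor
  · intro h Y f s hs
    obtain ⟨q, rfl, hq⟩ := exists_comp_map₂ L s (f ≫ p)
    have h' : f ≫ p ≫ mapPred L _ = _ ≫ tt _ := f ≫= h
    simp only [Category.assoc] at hs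
    simp only [← Category.assoc f] at hs h' ⊢
    rw [hq, hm] at hs
    rw [hq, Category.assoc, map_comp_mapPred, comp_tt] at h'
    rw [hq, hl]
    refine comp_mapPred_mono₂ L (fun T t h₁ h₂ => ?_) h' hs
    rw [le_iff, comp_m]
    rw [← Category.assoc, le_iff, comp_m, ← Category.assoc, m_sup_le_iff] at h₁
    have := h₁ T (𝟙 T) (t ≫ fst _ _) (by
      rw [comp_mem] at h₂
      simpa using h₂)
    simpa using this
  · intro h
    refine comp_mapPred_forall L (A := Q.carrier) (ζ := tt _)
      (φ := mem (fst _ _) (snd _ _ ≫ snd _ _ ≫ fst _ _))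
      (ψ := lift (Q.m (snd _ _ ≫ fst _ _) (fst _ _)) (snd _ _ ≫ snd _ _ ≫ snd _ _) ≫ Q.le)
      (fun T t _ ht => ?_) ?_ (fun Y f s hs => ?_)
    · rw [le_iff, comp_m, ← Category.assoc, m_sup_le_iff]
      intro V f s hs
      have := ht V f s (by rw [comp_mem]; simpa using hs)
      rw [le_iff, comp_m] at this
      simpa using this
    · rw [mapPred_tt, comp_tt]
    · have e1 : (lift s (f ≫ p) ≫ kappa L _ _) ≫ L.map (fst _ _) = s := by
        rw [Category.assoc, kappa_map_fst, lift_fst]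
      have e2 : (lift s (f ≫ p) ≫ kappa L _ _) ≫ L.map (snd _ _) = f ≫ p := by
        rw [Category.assoc, kappa_map_snd, lift_snd]
      rw [← Category.assoc] at hs ⊢
      rw [← hm, e1, e2] at hs
      have := h Y f s (by simpa only [Category.assoc] using hs)
      rw [← hl, e1, e2]
      simpa only [Category.assoc] using this

/-- Logical functors preserve internal commutative quantales. -/
lemma IsCommQuantale.map : (Q.map L).IsCommQuantale := by
  refine IsCommQuantale.of_m_sup_le_iff ?_ ?_ ?_ ?_ ?_ ?_ (map_m_sup_le_iff L Q)
  · intro X x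
    have := (map_le_comp_iff L Q x (𝟙 _) (𝟙 _)).2 (by
      have h : lift (𝟙 _) (𝟙 _) ≫ Q.le = tt _ := le_refl (Q := Q) (𝟙 Q.carrier)
      rw [h, mapPred_tt, comp_tt])
    simpa using this
  · intro X x y z
    obtain ⟨p, rfl, rfl, rfl⟩ := exists_comp_map₃ L x y z
    rw [map_le_comp_iff, map_le_comp_iff, map_le_comp_iff]
    refine comp_mapPred_mono₂ L fun T t h₁ h₂ => ?_
    rw [le_iff] at h₁ h₂ ⊢
    exact h₁.trans h₂
  · intro X x y
    obtain ⟨p, rfl, rfl⟩ := exists_comp_map₂ L x y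
    rw [map_le_comp_iff, map_le_comp_iff]
    intro h₁ h₂
    -- The conclusion of antisymmetry is an equality, expressed here as membership in the image of
    -- the diagonal, since `mapPred_inImage` allows this predicate to be read back in `F`.
    have := comp_mapPred_mono₂ L (ψ := inImage (lift (𝟙 Q.carrier) (𝟙 Q.carrier)))
      (fun T t h₁ h₂ => by
        rw [le_iff] at h₁ h₂
        have e : t = (t ≫ fst _ _) ≫ lift (𝟙 Q.carrier) (𝟙 Q.carrier) := by
          have := IsQuantale.le_antisymm _ _ h₁ h₂
          ext <;> simp [this]
        rw [e, self_comp_inImage]) h₁ h₂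
    rw [mapPred_inImage] at this
    -- Equality is turned into a truth value so that the image can be eliminated; then `p` factors
    -- through the image of the diagonal and its two components agree.
    rw [← lift_eqPred_eq_tt_iff]
    refine inImage_elim _ _ this _ fun T t i hi => ?_
    have e1 := hi =≫ L.map (fst _ _)
    have e2 := hi =≫ L.map (snd _ _)
    simp only [Category.assoc, ← L.map_comp, lift_fst, lift_snd] at e1 e2
    rw [← Category.assoc, comp_lift, lift_eqPred_eq_tt_iff]
    simp [e1, e2]
  · intro X x y z
    obtain ⟨p, rfl, rfl, rfl⟩ := exists_comp_map₃ L x y z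
    simp only [map_m_comp, IsQuantale.mul_assoc]
  · intro X x
    have h := map_m_comp L Q x (Q.one _) (𝟙 _)
    rw [one_m, map_one, comp_one] at h
    simpa using h
  · intro X x y
    obtain ⟨p, rfl, rfl⟩ := exists_comp_map₂ L x y
    rw [map_m_comp, map_m_comp, m_comm]

end QuantaleData

end

end ToposRel

/-! ### Behaviour of comparison maps, algebra homomorphisms and relations under `L`. -/

namespace ToposRel

noncomputable section

open QuantaleData

lemma Algebra.IsHom.inv {S : Signature.{w}} {E : Type u} [Category.{v} E] [ElementaryTopos E]
    {A B : Algebra S E} {f : A.carrier ≅ B.carrier} (hf : A.IsHom B f.hom) : B.IsHom A f.inv := by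
  intro σ X b
  have h := hf σ X fun i => b i ≫ f.inv
  rw [← cancel_mono f.hom]
  simpa using h.symm

/-- Since `y` is monic, the fibre of `g` over a point is, through `e`, the fibre of `f` over the
image of that point under `y`; so both joins have the same upper bounds. Applied with `y` a
comparison `kappa`. -/
lemma QuantaleData.comp_join {E : Type u} [Category.{v} E] [ElementaryTopos E] {Q : QuantaleData E}
    [Q.IsCommQuantale] {I J X Y : E} {q : I ⟶ Q.carrier} {f : I ⟶ X} {r : J ⟶ Q.carrier}
    {g : J ⟶ Y} (y : Y ⟶ X) [Mono y] (e : J ≅ I) (hr : e.hom ≫ q = r) (hg : g ≫ y = e.hom ≫ f) :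
    y ≫ Q.join q f = Q.join r g := by
  refine eq_of_le_iff fun z => ?_
  rw [join_le_iff, ← Category.id_comp (Q.join r g), join_le_iff]
  subst hr
  constructor
  · intro h T t i hi
    have := h T t (i ≫ e.hom) (by rw [Category.assoc, ← hg, ← Category.assoc, hi]; simp)
    rwa [Category.assoc] at this
  · intro h T t i hi
    have := h T t (i ≫ e.inv) (by
      rw [← cancel_mono y, Category.assoc, Category.assoc, hg]
      simpa using hi)
    simpa using this

section

variable {E : Type u₁} [Category.{v₁} E] [ElementaryTopos E] {F : Type u₂} [Category.{v₂} F]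
  [ElementaryTopos F] (L : E ⥤ F)

section

variable [PreservesFiniteProducts L]

/-- The canonical isomorphism `L A ⊗ L B ≅ L (A ⊗ B)`. -/
def kappaIso (A B : E) : L.obj A ⊗ L.obj B ≅ L.obj (A ⊗ B) :=
  (asIso (prodComparison L A B)).symm

instance (A B : E) : IsIso (kappa L A B) := inferInstanceAs (IsIso (inv (prodComparison L A B)))

lemma kappaIso_hom (A B : E) : (kappaIso L A B).hom = kappa L A B := rfl
lemma kappaIso_inv (A B : E) : (kappaIso L A B).inv = prodComparison L A B := rfl

/-- The canonical isomorphism `1 ≅ L 1`. -/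
def unitIso : 𝟙_ F ≅ L.obj (𝟙_ E) := (asIso (terminalComparison L)).symm

/-- A functor preserving finite products is monoidal. -/
def coreMonoidal : L.CoreMonoidal :=
  letI := Functor.OplaxMonoidal.ofChosenFiniteProducts L
  haveI : IsIso (Functor.OplaxMonoidal.η L) := inferInstanceAs (IsIso (terminalComparison L))
  haveI : ∀ A B, IsIso (Functor.OplaxMonoidal.δ L A B) := fun A B =>
    inferInstanceAs (IsIso (prodComparison L A B))
  .ofOplaxMonoidal L

/-- Coherence is inherited from the oplax structure given by `prodComparison`, whose inverses are by
definition the maps `kappa`. -/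
lemma kappa_associativity (A B C : E) :
    kappa L A B ▷ L.obj C ≫ kappa L (A ⊗ B) C ≫ L.map (α_ A B C).hom =
      (α_ (L.obj A) (L.obj B) (L.obj C)).hom ≫ L.obj A ◁ kappa L B C ≫ kappa L A (B ⊗ C) :=
  (coreMonoidal L).associativity A B C

lemma kappa_left_unitality (A : E) :
    (λ_ (L.obj A)).hom = (unitIso L).hom ▷ L.obj A ≫ kappa L (𝟙_ E) A ≫ L.map (λ_ A).hom :=
  (coreMonoidal L).left_unitality A

lemma kappa_right_unitality (A : E) :
    (ρ_ (L.obj A)).hom = L.obj A ◁ (unitIso L).hom ≫ kappa L A (𝟙_ E) ≫ L.map (ρ_ A).hom :=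
  (coreMonoidal L).right_unitality A

variable {S : Signature.{w}}

lemma Algebra.IsHom.map {A B : Algebra S E} {f : A.carrier ⟶ B.carrier} (hf : A.IsHom B f) :
    (A.map L).IsHom (B.map L) (L.map f) := by
  intro σ X a
  -- At the universal tuple of projections, the homomorphism condition is a single equation in `E`,
  -- which `L` preserves; an arbitrary tuple in `F` is then substituted.
  let π := fun i => Pi.π (fun _ : Fin (S.arity σ) => A.carrier) i
  have h := hf σ _ π
  have e : Pi.lift π = 𝟙 _ := by ext i; simp [π]
  rw [e, Category.id_comp] at h
  have h' : kappaPow L (S.arity σ) A.carrier ≫ L.map (Pi.lift fun i => π i ≫ f) =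
      Pi.lift (fun i => Pi.π (fun _ => L.obj A.carrier) i ≫ L.map f) ≫
        kappaPow L (S.arity σ) B.carrier := by
    rw [← piLift_map_kappaPow, ← Category.assoc]
    congr 1
    ext i
    simp only [π, L.map_comp, Category.assoc, Pi.lift_π]
    rw [← Category.assoc, kappaPow_map_π]
  have h'' : Pi.lift a ≫ Pi.lift (fun i => Pi.π (fun _ => L.obj A.carrier) i ≫ L.map f) =
      Pi.lift fun i => a i ≫ L.map f := by
    ext i; simp
  rw [Category.assoc, ← L.map_comp, h, L.map_comp, ← Category.assoc (kappaPow _ _ _), h',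
    ← h'']
  simp only [Category.assoc]

/-- The inverse `prodComparison` pairs the images of the two projections, which are homomorphisms.
-/
lemma isHom_kappa (A B : Algebra S E) :
    ((A.map L).prod (B.map L)).IsHom ((A.prod B).map L) (kappa L A.carrier B.carrier) := by
  refine Algebra.IsHom.inv (A := (A.prod B).map L) (B := (A.map L).prod (B.map L))
    (f := asIso (prodComparison L A.carrier B.carrier)) ?_
  exact ((Algebra.isHom_fst A B).map L).lift ((Algebra.isHom_snd A B).map L)

lemma isHom_prodComparison (A B : Algebra S E) :
    ((A.prod B).map L).IsHom ((A.map L).prod (B.map L)) (prodComparison L A.carrier B.carrier) :=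
  ((Algebra.isHom_fst A B).map L).lift ((Algebra.isHom_snd A B).map L)

lemma isHom_terminalComparison :
    ((Algebra.unit S E).map L).IsHom (Algebra.unit S F) (terminalComparison L) :=
  Algebra.isHom_toUnit _

lemma isHom_unitIso :
    (Algebra.unit S F).IsHom ((Algebra.unit S E).map L) (unitIso L).hom :=
  Algebra.IsHom.inv (A := (Algebra.unit S E).map L) (B := Algebra.unit S F)
    (f := asIso (terminalComparison L)) (isHom_terminalComparison L)

end

variable [IsLogical L] {Q : QuantaleData E}

lemma ap_mapRel_tensorRel {A B A' B' : E} {X : F} (R : A ⊗ B ⟶ Q.carrier)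
    (R' : A' ⊗ B' ⟶ Q.carrier) (a : X ⟶ L.obj (A ⊗ A')) (b : X ⟶ L.obj (B ⊗ B')) :
    ap (Q := Q.map L) (mapRel L (tensorRel R R')) a b =
      (Q.map L).m
        (ap (Q := Q.map L) (mapRel L R) (a ≫ L.map (fst _ _)) (b ≫ L.map (fst _ _)))
        (ap (Q := Q.map L) (mapRel L R') (a ≫ L.map (snd _ _)) (b ≫ L.map (snd _ _))) := by
  have h1 : lift a b ≫ kappa L _ _ ≫ L.map (fst _ _) = a := by rw [kappa_map_fst, lift_fst]
  have h2 : lift a b ≫ kappa L _ _ ≫ L.map (snd _ _) = b := by rw [kappa_map_snd, lift_snd]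
  rw [ap, mapRel, tensorRel, map_m, ← Category.assoc, comp_m, map_ap, map_ap, comp_ap, comp_ap]
  simp only [L.map_comp]
  simp only [← Category.assoc] at h1 h2 ⊢
  rw [h1, h2]

variable [(Q.map L).IsCommQuantale]

lemma mapRel_graphRel {A B : E} (f : A ⟶ B) :
    mapRel L (graphRel Q f) = graphRel (Q.map L) (L.map f) := by
  rw [mapRel, graphRel, map_join]
  refine comp_join (kappa L A B) (Iso.refl _) ?_ ?_
  · rw [map_one]
    exact Category.id_comp _
  · rw [← L.map_id, lift_map_kappa]
    exact (Category.id_comp _).symm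

lemma mapRel_idRel (A : E) : mapRel L (idRel Q A) = idRel (Q.map L) (L.obj A) := by
  rw [idRel_eq_graphRel, mapRel_graphRel, L.map_id, idRel_eq_graphRel]

lemma mapRel_compRel {A B C : E} (R : A ⊗ B ⟶ Q.carrier) (R' : B ⊗ C ⟶ Q.carrier) :
    mapRel L (compRel R R') = compRel (Q := Q.map L) (mapRel L R) (mapRel L R') := by
  -- Change of index for the join over triples (a, b, c) that defines the composite.
  let e : L.obj A ⊗ (L.obj B ⊗ L.obj C) ≅ L.obj (A ⊗ (B ⊗ C)) :=
    whiskerLeftIso (L.obj A) (kappaIso L B C) ≪≫ kappaIso L A (B ⊗ C)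
  have e1 : e.hom ≫ L.map (fst _ _) = fst _ _ := by
    simp [e, kappaIso_hom, kappa_map_fst]
  have e2 : e.hom ≫ L.map (snd _ _) = snd _ _ ≫ kappa L B C := by
    simp [e, kappaIso_hom, kappa_map_snd]
  have e3 : e.hom ≫ L.map (snd _ _ ≫ fst _ _) = snd _ _ ≫ fst _ _ := by
    rw [L.map_comp, ← Category.assoc, e2, Category.assoc, kappa_map_fst]
  have e4 : e.hom ≫ L.map (snd _ _ ≫ snd _ _) = snd _ _ ≫ snd _ _ := by
    rw [L.map_comp, ← Category.assoc, e2, Category.assoc, kappa_map_snd]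
  rw [mapRel, compRel, map_join]
  refine comp_join (kappa L A C) e ?_ ?_
  · rw [map_m, comp_m, map_ap, map_ap, comp_ap, comp_ap, e1, e3, e4]
  · rw [comp_map_lift, e1, e4]

/-- Composing with the graph of an isomorphism is a substitution, after which both sides evaluate to
the product of the two relations on components. -/
lemma mapRel_tensorRel_naturality {A B A' B' : E} (R : A ⊗ B ⟶ Q.carrier)
    (R' : A' ⊗ B' ⟶ Q.carrier) :
    compRel (Q := Q.map L) (tensorRel (Q := Q.map L) (mapRel L R) (mapRel L R'))
        (graphRel (Q.map L) (kappa L B B')) =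
      compRel (Q := Q.map L) (graphRel (Q.map L) (kappa L A A')) (mapRel L (tensorRel R R')) := by
  rw [graphRel_compRel, ← kappaIso_hom L B B', compRel_graphRel]
  refine rel_ext fun X a b => ?_
  rw [ap_whiskerLeft, ap_whiskerRight, ap_mapRel_tensorRel, ap_tensorRel, kappaIso_inv]
  simp only [Category.assoc, kappa_map_fst, kappa_map_snd,
    CartesianMonoidalCategory.prodComparison_fst, CartesianMonoidalCategory.prodComparison_snd]

end

/-! ### The induced symmetric monoidal functor. -/

section Induced

variable (S : Signature.{w}) {E : Type u₁} [Category.{v₁} E] [ElementaryTopos E] {F : Type u₂}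
    [Category.{v₂} F] [ElementaryTopos F] (L : E ⥤ F) [IsLogical L]
    (Q : QuantaleData E) [Q.IsCommQuantale] (Q' : QuantaleData F) [Q'.IsCommQuantale]
    (h : Q.map L = Q')

lemma rel_relMap [(Q.map L).IsCommQuantale] {A B : Rel S Q} (R : A ⟶ B) :
    Rel.rel ((relMap S L Q (Q.map L) rfl).map R) = mapRel L (Rel.rel R) :=
  Category.comp_id _

/-- The functor between categories of relations induced by a logical functor. -/
def relMapFunctor : Rel S Q ⥤ Rel S Q' where
  obj := (relMap S L Q Q' h).obj
  map := (relMap S L Q Q' h).map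
  map_id A := by
    subst h
    exact Rel.hom_ext ((rel_relMap S L Q _).trans (mapRel_idRel L A.alg.carrier))
  map_comp R R' := by
    subst h
    refine Rel.hom_ext ((rel_relMap S L Q _).trans
      ((mapRel_compRel L (Rel.rel R) (Rel.rel R')).trans ?_))
    exact congrArg₂ (compRel (Q := Q.map L)) (rel_relMap S L Q R).symm (rel_relMap S L Q R').symm

lemma rel_relMapFunctor [(Q.map L).IsCommQuantale] {A B : Rel S Q} (R : A ⟶ B) :
    Rel.rel ((relMapFunctor S L Q (Q.map L) rfl).map R) = mapRel L (Rel.rel R) :=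
  Category.comp_id _

variable {S L Q Q'}

/-- Handles the images of structural isomorphisms, which are graphs; coherence laws thereby become
equations between morphisms of `F`. -/
lemma rel_relMapFunctor_of_graphRel {A B : Rel S Q} {R : A ⟶ B}
    {f : A.alg.carrier ⟶ B.alg.carrier} (hR : Rel.rel R = graphRel Q f) :
    Rel.rel ((relMapFunctor S L Q Q' h).map R) = graphRel Q' (L.map f) := by
  subst h
  exact (rel_relMapFunctor S L Q R).trans ((congrArg (mapRel L) hR).trans (mapRel_graphRel L f))

lemma relMapFunctor_tensorHom_naturality {A B A' B' : Rel S Q} (R : A ⟶ B) (R' : A' ⟶ B') :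
    compRel (tensorRel (Rel.rel ((relMapFunctor S L Q Q' h).map R))
        (Rel.rel ((relMapFunctor S L Q Q' h).map R')))
        (graphRel Q' (kappa L B.alg.carrier B'.alg.carrier)) =
      compRel (graphRel Q' (kappa L A.alg.carrier A'.alg.carrier))
        (Rel.rel ((relMapFunctor S L Q Q' h).map (R ⊗ₘ R'))) := by
  subst h
  have h1 := rel_relMapFunctor S L Q R
  have h2 := rel_relMapFunctor S L Q R'
  have h3 := rel_relMapFunctor S L Q (R ⊗ₘ R')
  rw [h1, h2, h3]
  exact mapRel_tensorRel_naturality L (Rel.rel R) (Rel.rel R')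

variable (S L Q Q')

/-- The monoidal structure on the functor induced by a logical functor. -/
def relMapCoreMonoidal : (relMapFunctor S L Q Q' h).CoreMonoidal where
  εIso := Rel.graphIso (unitIso L) (isHom_unitIso L) (isHom_terminalComparison L)
  μIso A B := Rel.graphIso (kappaIso L A.alg.carrier B.alg.carrier)
    (isHom_kappa L A.alg B.alg) (isHom_prodComparison L A.alg B.alg)
  μIso_hom_natural_left {A B} R C := by
    -- Whiskering is tensoring with an identity, so one-sided naturality is a case of joint
    -- naturality.
    rw [← tensorHom_id, ← tensorHom_id, ← CategoryTheory.Functor.map_id]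
    exact Rel.hom_ext (relMapFunctor_tensorHom_naturality h R (𝟙 C))
  μIso_hom_natural_right {A B} C R := by
    rw [← id_tensorHom, ← id_tensorHom, ← CategoryTheory.Functor.map_id]
    exact Rel.hom_ext (relMapFunctor_tensorHom_naturality h (𝟙 C) R)
  associativity A B C := by
    refine Rel.hom_ext ?_
    change compRel (tensorRel (graphRel Q' (kappa L _ _)) (graphRel Q' (𝟙 (L.obj C.alg.carrier))))
      (compRel (graphRel Q' (kappa L _ _))
        (Rel.rel ((relMapFunctor S L Q Q' h).map (α_ A B C).hom))) =
      compRel (graphRel Q' (α_ (L.obj A.alg.carrier) _ _).hom)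
        (compRel (tensorRel (graphRel Q' (𝟙 (L.obj A.alg.carrier))) (graphRel Q' (kappa L _ _)))
          (graphRel Q' (kappa L _ _)))
    rw [rel_relMapFunctor_of_graphRel h
      (f := (α_ A.alg.carrier B.alg.carrier C.alg.carrier).hom) rfl]
    -- Each side collapses to the graph of one morphism, leaving the associativity coherence of
    -- `kappa`.
    refine ((congrArg₂ compRel (tensorRel_graphRel _ _) (graphRel_comp _ _)).trans
      (graphRel_comp _ _)).trans (Eq.trans ?_ ((congrArg (compRel _) ((congrArg₂ compRel
        (tensorRel_graphRel _ _) rfl).trans (graphRel_comp _ _))).trans (graphRel_comp _ _)).symm)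
    rw [tensorHom_id, id_tensorHom]
    exact congrArg _ (kappa_associativity L _ _ _)
  left_unitality A := by
    refine Rel.hom_ext ?_
    change graphRel Q' (λ_ (L.obj A.alg.carrier)).hom =
      compRel (tensorRel (graphRel Q' (unitIso L).hom) (graphRel Q' (𝟙 (L.obj A.alg.carrier))))
        (compRel (graphRel Q' (kappa L _ _)) (Rel.rel ((relMapFunctor S L Q Q' h).map (λ_ A).hom)))
    rw [rel_relMapFunctor_of_graphRel h (f := (λ_ A.alg.carrier).hom) rfl]
    refine Eq.trans ?_ ((congrArg₂ compRel (tensorRel_graphRel _ _) (graphRel_comp _ _)).trans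
      (graphRel_comp _ _)).symm
    rw [tensorHom_id]
    exact congrArg _ (kappa_left_unitality L _)
  right_unitality A := by
    refine Rel.hom_ext ?_
    change graphRel Q' (ρ_ (L.obj A.alg.carrier)).hom =
      compRel (tensorRel (graphRel Q' (𝟙 (L.obj A.alg.carrier))) (graphRel Q' (unitIso L).hom))
        (compRel (graphRel Q' (kappa L _ _)) (Rel.rel ((relMapFunctor S L Q Q' h).map (ρ_ A).hom)))
    rw [rel_relMapFunctor_of_graphRel h (f := (ρ_ A.alg.carrier).hom) rfl]
    refine Eq.trans ?_ ((congrArg₂ compRel (tensorRel_graphRel _ _) (graphRel_comp _ _)).trans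
      (graphRel_comp _ _)).symm
    rw [id_tensorHom]
    exact congrArg _ (kappa_right_unitality L _)

lemma kappa_map_swap {E : Type u₁} [Category.{v₁} E] [ElementaryTopos E] {F : Type u₂}
    [Category.{v₂} F] [ElementaryTopos F] (L : E ⥤ F) [IsLogical L] (A B : E) :
    kappa L A B ≫ L.map (swapIso A B).hom = (swapIso (L.obj A) (L.obj B)).hom ≫ kappa L B A := by
  rw [swapIso_hom, comp_map_lift, kappa_map_fst, kappa_map_snd, swapIso_hom]

/-- The symmetric monoidal functor between categories of relations induced by a logical functor. -/
def relStar : SymMonFunctor (Rel S Q) (Rel S Q') where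
  toFunctor := relMapFunctor S L Q Q' h
  braided :=
    { (relMapCoreMonoidal S L Q Q' h).toMonoidal with
      braided A B := by
        refine Rel.hom_ext ?_
        change compRel (graphRel Q' (kappa L _ _))
          (Rel.rel ((relMapFunctor S L Q Q' h).map (β_ A B).hom)) =
          compRel (graphRel Q' (swapIso (L.obj A.alg.carrier) (L.obj B.alg.carrier)).hom)
            (graphRel Q' (kappa L _ _))
        rw [rel_relMapFunctor_of_graphRel h (f := (swapIso A.alg.carrier B.alg.carrier).hom) rfl]
        refine (graphRel_comp _ _).trans (Eq.trans ?_ (graphRel_comp _ _).symm)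
        exact congrArg _ (kappa_map_swap L _ _) }

end Induced

/-! ### Identities and composites of logical functors. -/

section Functoriality

/-- Two symmetric monoidal functors agree if they agree up to equality of objects. -/
lemma SymMonFunctor.ext_of_eqToHom {C : Type u₁} [Category.{v₁} C] [MonoidalCategory C]
    [SymmetricCategory C] {D : Type u₂} [Category.{v₂} D] [MonoidalCategory D]
    [SymmetricCategory D] (G H : SymMonFunctor C D) (hobj : ∀ A, G.obj A = H.obj A)
    (hmap : ∀ (A B : C) (f : A ⟶ B),
      G.map f = eqToHom (hobj A) ≫ H.map f ≫ eqToHom (hobj B).symm)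
    (hε : G.braided.ε = H.braided.ε ≫ eqToHom (hobj _).symm)
    (hμ : ∀ A B : C, G.braided.μ A B = (eqToHom (hobj A) ⊗ₘ eqToHom (hobj B)) ≫
      H.braided.μ A B ≫ eqToHom (hobj _).symm) : G = H := by
  obtain ⟨G, bG⟩ := G
  obtain ⟨H, bH⟩ := H
  obtain rfl : G = H := CategoryTheory.Functor.ext hobj hmap
  congr
  have h1 : bG.toLaxMonoidal = bH.toLaxMonoidal := by
    ext A B
    · simpa using hε
    · simpa using hμ A B
  -- The oplax half of a strong monoidal structure is inverse to the lax half, so the latter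
  -- determines everything.
  have h2 : bG.toMonoidal = bH.toMonoidal := by
    exact Functor.Monoidal.toLaxMonoidal_injective _ h1
  cases bG
  cases bH
  cases h2
  rfl

/-- In the applications below the carriers agree by definition, so the transport is an identity
relation. -/
lemma Rel.rel_eqToHom {S : Signature.{w}} {E : Type u} [Category.{v} E] [ElementaryTopos E]
    {Q : QuantaleData E} [Q.IsCommQuantale] {A B : Rel S Q} (h : A = B) :
    Rel.rel (eqToHom h) = graphRel Q (eqToHom (congrArg (fun A : Rel S Q => A.alg.carrier) h)) := by
  subst h
  rfl


variable (S : Signature.{w}) {E : Type u₁} [Category.{v₁} E] [ElementaryTopos E] {F : Type u₂}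
  [Category.{v₂} F] [ElementaryTopos F] {G : Type u₃} [Category.{v₃} G] [ElementaryTopos G]

/-- Only the operations can differ, by the comparison `kappaPow`, which is an identity here. -/
lemma Algebra.map_id {S : Signature.{w}} (A : Algebra S E) : A.map (𝟭 E) = A := by
  refine Algebra.ext rfl (heq_of_eq (funext fun σ => ?_))
  exact (congrArg (· ≫ A.op σ) (kappaPow_id _ _)).trans (Category.id_comp _)

lemma Algebra.map_comp {S : Signature.{w}} (A : Algebra S E) (L : E ⥤ F) (K : F ⥤ G)
    [PreservesFiniteProducts L] [PreservesFiniteProducts K] :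
    A.map (L ⋙ K) = (A.map L).map K := by
  refine Algebra.ext rfl (heq_of_eq (funext fun σ => ?_))
  refine (congrArg (· ≫ K.map (L.map (A.op σ))) (kappaPow_comp L K _ _)).trans ?_
  rw [Category.assoc, ← K.map_comp]

lemma compRel_idRel_idRel {Q : QuantaleData E} [Q.IsCommQuantale] {A B : E}
    (R : A ⊗ B ⟶ Q.carrier) : compRel (idRel Q A) (compRel R (idRel Q B)) = R := by
  rw [compRel_id, id_compRel]

lemma relStar_id (Q : QuantaleData E) [Q.IsCommQuantale] (h : Q.map (𝟭 E) = Q) :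
    relStar S (𝟭 E) Q Q h = SymMonFunctor.id (Rel S Q) := by
  have hobj : ∀ A : Rel S Q, (relStar S (𝟭 E) Q Q h).obj A = (SymMonFunctor.id (Rel S Q)).obj A :=
    fun A => Rel.ext (Algebra.map_id A.alg)
  refine SymMonFunctor.ext_of_eqToHom _ _ hobj (fun A B R => Rel.hom_ext ?_) (Rel.hom_ext ?_)
    (fun A B => Rel.hom_ext ?_)
  · have hA : Rel.rel (eqToHom (hobj A)) = idRel Q A.alg.carrier := Rel.rel_eqToHom (hobj A)
    have hB : Rel.rel (eqToHom (hobj B).symm) = idRel Q B.alg.carrier :=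
      Rel.rel_eqToHom (hobj B).symm
    have h1 : Rel.rel ((relStar S (𝟭 E) Q Q h).map R) = Rel.rel R := by
      refine (Category.comp_id _).trans ?_
      exact (congrArg (· ≫ Rel.rel R) (kappa_id _ _)).trans (Category.id_comp _)
    refine h1.trans ((compRel_idRel_idRel (Rel.rel R)).symm.trans ?_)
    exact congrArg₂ compRel hA.symm (congrArg (compRel (Rel.rel R)) hB.symm)
  · have h1 : Rel.rel (eqToHom (hobj (𝟙_ _)).symm) = idRel Q (𝟙_ E) := Rel.rel_eqToHom _
    refine Eq.trans ?_ ((congrArg (compRel (idRel Q (𝟙_ E))) h1).trans (compRel_id _)).symm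
    exact congrArg (graphRel Q) (Subsingleton.elim (α := _ ⟶ 𝟙_ E) _ _)
  · have hA : Rel.rel (eqToHom (hobj A)) = idRel Q A.alg.carrier := Rel.rel_eqToHom (hobj A)
    have hB : Rel.rel (eqToHom (hobj B)) = idRel Q B.alg.carrier := Rel.rel_eqToHom (hobj B)
    have hAB : Rel.rel (eqToHom (hobj (A ⊗ B)).symm) = idRel Q (A.alg.carrier ⊗ B.alg.carrier) :=
      Rel.rel_eqToHom _
    have hT := (congrArg₂ tensorRel hA hB).trans (tensorRel_id (Q := Q) _ _)
    refine Eq.trans (congrArg (graphRel Q) (kappa_id A.alg.carrier B.alg.carrier)) ?_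
    refine (compRel_idRel_idRel (idRel Q (A.alg.carrier ⊗ B.alg.carrier))).symm.trans ?_
    exact congrArg₂ compRel hT.symm (congrArg (compRel _) hAB.symm)

lemma relStar_comp (L : E ⥤ F) [IsLogical L] (K : F ⥤ G) [IsLogical K]
    (Q : QuantaleData E) [Q.IsCommQuantale] (Q' : QuantaleData F) [Q'.IsCommQuantale]
    (Q'' : QuantaleData G) [Q''.IsCommQuantale]
    (h : Q.map L = Q') (h' : Q'.map K = Q'') (h'' : Q.map (L ⋙ K) = Q'') :
    relStar S (L ⋙ K) Q Q'' h'' = (relStar S L Q Q' h).comp (relStar S K Q' Q'' h') := by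
  have hobj : ∀ A : Rel S Q, (relStar S (L ⋙ K) Q Q'' h'').obj A =
      ((relStar S L Q Q' h).comp (relStar S K Q' Q'' h')).obj A :=
    fun A => Rel.ext (Algebra.map_comp A.alg L K)
  refine SymMonFunctor.ext_of_eqToHom _ _ hobj (fun A B R => Rel.hom_ext ?_) (Rel.hom_ext ?_)
    (fun A B => Rel.hom_ext ?_)
  · have hA : Rel.rel (eqToHom (hobj A)) = idRel Q'' (K.obj (L.obj A.alg.carrier)) :=
      Rel.rel_eqToHom (hobj A)
    have hB : Rel.rel (eqToHom (hobj B).symm) = idRel Q'' (K.obj (L.obj B.alg.carrier)) :=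
      Rel.rel_eqToHom (hobj B).symm
    -- On relations, functoriality is the formula `kappa_comp` for the comparison of a composite.
    have h1 : Rel.rel ((relStar S (L ⋙ K) Q Q'' h'').map R) =
        Rel.rel (((relStar S L Q Q' h).comp (relStar S K Q' Q'' h')).map R) := by
      subst h h'
      refine (Category.comp_id _).trans (Eq.trans ?_ (Category.comp_id _).symm)
      refine Eq.trans ?_ (congrArg (mapRel K) (Category.comp_id (mapRel L (Rel.rel R)))).symm
      refine (congrArg (· ≫ K.map (L.map (Rel.rel R))) (kappa_comp L K _ _)).trans ?_
      rw [Category.assoc, ← K.map_comp]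
      rfl
    refine h1.trans ((compRel_idRel_idRel _).symm.trans ?_)
    exact congrArg₂ compRel hA.symm (congrArg (compRel _) hB.symm)
  · have h1 : Rel.rel (eqToHom (hobj (𝟙_ _)).symm) = idRel Q'' (K.obj (L.obj (𝟙_ E))) :=
      Rel.rel_eqToHom _
    -- The unit of the composite applies the second functor to the unit of the first, and graphs go
    -- to graphs.
    have h2 : Rel.rel ((relStar S K Q' Q'' h').map (relStar S L Q Q' h).braided.ε) =
        graphRel Q'' (K.map (unitIso L).hom) := rel_relMapFunctor_of_graphRel h' rfl
    have h3 : Rel.rel ((relStar S L Q Q' h).comp (relStar S K Q' Q'' h')).braided.ε =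
        graphRel Q'' ((unitIso K).hom ≫ K.map (unitIso L).hom) :=
      (congrArg (compRel (graphRel Q'' (unitIso K).hom)) h2).trans (graphRel_comp _ _)
    refine Eq.trans ?_ ((congrArg₂ compRel h3 h1).trans (compRel_id _)).symm
    refine congrArg (graphRel Q'') ?_
    exact inv_eq_of_eq_map_comp K (terminalComparison L) (terminalComparison K)
      (terminalComparison (L ⋙ K)) (Subsingleton.elim _ _)
  · have hA : Rel.rel (eqToHom (hobj A)) = idRel Q'' (K.obj (L.obj A.alg.carrier)) :=
      Rel.rel_eqToHom (hobj A)
    have hB : Rel.rel (eqToHom (hobj B)) = idRel Q'' (K.obj (L.obj B.alg.carrier)) :=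
      Rel.rel_eqToHom (hobj B)
    have hAB : Rel.rel (eqToHom (hobj (A ⊗ B)).symm) =
        idRel Q'' (K.obj (L.obj (A.alg.carrier ⊗ B.alg.carrier))) := Rel.rel_eqToHom _
    have hT := (congrArg₂ tensorRel hA hB).trans (tensorRel_id (Q := Q'') _ _)
    have h2 : Rel.rel ((relStar S K Q' Q'' h').map ((relStar S L Q Q' h).braided.μ A B)) =
        graphRel Q'' (K.map (kappa L A.alg.carrier B.alg.carrier)) :=
      rel_relMapFunctor_of_graphRel h' rfl
    have h3 : Rel.rel (((relStar S L Q Q' h).comp (relStar S K Q' Q'' h')).braided.μ A B) =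
        graphRel Q'' (kappa K _ _ ≫ K.map (kappa L A.alg.carrier B.alg.carrier)) :=
      (congrArg (compRel (graphRel Q'' (kappa K _ _))) h2).trans (graphRel_comp _ _)
    refine Eq.trans (congrArg (graphRel Q'') (kappa_comp L K _ _)) ?_
    refine h3.symm.trans ((compRel_idRel_idRel _).symm.trans ?_)
    exact congrArg₂ compRel hT.symm (congrArg (compRel _) hAB.symm)

end Functoriality

end

end ToposRel

/-- Letting the target be any `Q'` with `Q.map L = Q'` avoids transporting categories along
`QuantaleData.map_id` and `QuantaleData.map_comp`, which supply the equations assumed in the last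
two clauses. -/
theorem mainTheorem9 (S : Signature.{w}) :
    (∀ {E : Type u} [Category.{v} E] [ElementaryTopos E] {F : Type u} [Category.{v} F]
      [ElementaryTopos F] (L : E ⥤ F) [IsLogical L] (Q : QuantaleData E),
      Q.IsCommQuantale → (Q.map L).IsCommQuantale) ∧
    ∃ star : ∀ {E : Type u} [Category.{v} E] [ElementaryTopos E] {F : Type u} [Category.{v} F]
        [ElementaryTopos F] (L : E ⥤ F) [IsLogical L]
        (Q : QuantaleData E) [Q.IsCommQuantale] (Q' : QuantaleData F) [Q'.IsCommQuantale],
        Q.map L = Q' → SymMonFunctor (Rel S Q) (Rel S Q'),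
      (∀ {E : Type u} [Category.{v} E] [ElementaryTopos E] {F : Type u} [Category.{v} F]
        [ElementaryTopos F] (L : E ⥤ F) [IsLogical L]
        (Q : QuantaleData E) [Q.IsCommQuantale] (Q' : QuantaleData F) [Q'.IsCommQuantale]
        (h : Q.map L = Q'),
        (star L Q Q' h).toPrefunctor = relMap S L Q Q' h) ∧
      (∀ {E : Type u} [Category.{v} E] [ElementaryTopos E]
        (Q : QuantaleData E) [Q.IsCommQuantale] (h : Q.map (𝟭 E) = Q),
        star (𝟭 E) Q Q h = SymMonFunctor.id (Rel S Q)) ∧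
      (∀ {E : Type u} [Category.{v} E] [ElementaryTopos E] {F : Type u} [Category.{v} F]
        [ElementaryTopos F] {G : Type u} [Category.{v} G] [ElementaryTopos G]
        (L : E ⥤ F) [IsLogical L] (K : F ⥤ G) [IsLogical K]
        (Q : QuantaleData E) [Q.IsCommQuantale] (Q' : QuantaleData F) [Q'.IsCommQuantale]
        (Q'' : QuantaleData G) [Q''.IsCommQuantale]
        (h : Q.map L = Q') (h' : Q'.map K = Q'') (h'' : Q.map (L ⋙ K) = Q''),
        star (L ⋙ K) Q Q'' h'' = (star L Q Q' h).comp (star K Q' Q'' h')) := by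
  refine ⟨fun L _ Q _ => QuantaleData.IsCommQuantale.map L Q,
    fun L _ Q _ Q' _ h => relStar S L Q Q' h, ?_, ?_, ?_⟩
  · intros
    rfl
  · intro E _ _ Q _ h
    exact relStar_id S Q h
  · intro E _ _ F _ _ G _ _ L _ K _ Q _ Q' _ Q'' _ h h' h''
    exact relStar_comp S L K Q Q' Q'' h h' h''
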